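/- **Operators of C-type.** Let $(e_k)_{k\ge 0}$ be the canonical basis of the complex space $\ell_1(\mathbb N)$. Let $v=(v_n)_{n\ge1}$ be a bounded sequence of non-zero complex numbers, $w=(w_j)_{j\ge1}$ a sequence of complex numbers with $0<\inf_j|w_j|\le\sup_j|w_j|<\infty$, $\varphi:\mathbb N\to\mathbb N$ a map with $\varphi(0)=0$, $\varphi(n)<n$ for $n\ge1$ and $\varphi^{-1}(l)$ infinite for every $l\ge0$, and $b=(b_n)_{n\ge0}$ a strictly increasing sequence of integers with $b_0=0$ such that $b_{n+1}-b_n$ is a multiple of $2(b_{\varphi(n)+1}-b_{\varphi(n)})$ for every $n\ge1$. Assume $\inf_{n\ge0}\prod_{j=b_n+1}^{b_{n+1}-1}|w_j|>0$. The operator of C-type $T=T_{v,w,\varphi,b}$ is the bounded operator on $\ell_1(\mathbb N)$ with $Te_k=w_{k+1}e_{k+1}$ if $k\in[b_n,b_{n+1}-1)$, $n\ge0$; $Te_{b_{n+1}-1}=v_ne_{b_{\varphi(n)}}-\bigl(\prod_{j=b_n+1}^{b_{n+1}-1}w_j\bigr)^{-1}e_{b_n}$ for $n\ge1$; and $Te_{b_1-1}=-\bigl(\prod_{j=b_0+1}^{b_1-1}w_j\bigr)^{-1}e_0$.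 **Parameters.** Let $\psi=(\psi_1,\psi_2)$ be a map from $\{1,2,\dots\}$ to pairs of integers such that for every $k\ge1$ $$1\le\psi_1(k)<\min\{k+1,\psi_2(k)\},\qquad \psi_2(k)>\psi_2(j)\ \text{ for all } 1\le j<\psi_1(k),$$ and such that for every $i\ge1$ there is $j_i$ such that for every $j\ge j_i$ the set $\{k\ge1:\psi(k)=(i,j)\}$ is infinite. Let $n_0=0$, $n_1=1$ and $n_{k+1}=n_k+\psi_1(k)$ for $k\ge1$. Let $(\delta^{(k)})_{k\ge1}$ and $(\tau^{(k)})_{k\ge1}$ be non-decreasing sequences of positive integers, let $\delta^{(0)}$ be any non-negative integer, and let $(\Delta^{(k)})_{k\ge0}$ be integers with $\Delta^{(0)}=b_1-b_0$ such that, for every $k\ge1$, $\Delta^{(k)}$ is a multiple of $2\Delta^{(k-1)}$ and $(k+3)\delta^{(\psi_2(k))}+4n_{k+1}+2<\Delta^{(k)}$. Suppose that for every $k\ge1$ and every $n\in[n_k,n_{k+1})$ we have $\varphi(n)=n-n_k$, $v_n=2^{-\tau^{(\psi_2(k))}}$, $b_{n+1}-b_n=\Delta^{(k)}$ and, for $1\le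 i<\Delta^{(k)}$, writing $d=\delta^{(\psi_2(k))}$, $$w_{b_n+i}=\begin{cases}2&\text{if } 0<i\le kd+2n+1,\\ 1&\text{if } kd+2n+1<i<\Delta^{(k)}-3d-2n-1,\\ 1/2&\text{if } \Delta^{(k)}-3d-2n-1\le i<\Delta^{(k)}-2d,\\ 2&\text{if } \Delta^{(k)}-2d\le i<\Delta^{(k)}-d,\\ 1&\text{if } \Delta^{(k)}-d\le i<\Delta^{(k)}.\end{cases}$$ Let $T$ be the associated operator of C-type on $\ell_1(\mathbb N)$. **Theorem.** For $k\ge1$ set $\gamma_k:=2^{k\delta^{(k-1)}+2n_k+1-\tau^{(k)}}$. Suppose that for every $k\ge1$ we have $\gamma_k\le2^{-16k}$ and $\gamma_k\le\gamma_s^2$ for all $1\le s\le k-1$, and that $$\lim_{k\to\infty}\frac{k\delta^{(k)}}{\delta^{(k+1)}}=0\quad\text{and}\quad\lim_{k\to\infty}\frac{k\delta^{(\psi_2(k))}+n_{k+1}}{\Delta^{(k)}}=0 .$$ Then $T$ is not frequently hypercyclic, that is, there is no $x\in\ell_1(\mathbb N)$ such that for every non-empty open set $U$ the set $\{j\ge0:T^jx\in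 U\}$ has positive lower density. Moreover, for every hypercyclic vector $x$ of $T$ (a vector with dense orbit) there is $r>0$ such that the set $\{j\ge0:\|T^jx\|\ge r\}$ has upper density $1$. -/

import Mathlib

open Filter Topology

noncomputable section

namespace CType

section Dynamics

/-- Upper (natural) density of a set of non-negative integers. -/
def upperDensity (A : Set ℕ) : ℝ :=
  limsup (fun N : ℕ => ((A ∩ Set.Iic N).ncard : ℝ) / ((N : ℝ) + 1)) atTop

/-- Lower (natural) density of a set of non-negative integers. -/
def lowerDensity (A : Set ℕ) : ℝ :=
  liminf (fun N : ℕ => ((A ∩ Set.Iic N).ncard : ℝ) / ((N : ℝ) + 1)) atTop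

/-- The set `N(x, U) = {n ≥ 0 : Tⁿ x ∈ U}` of visiting times of the orbit of `x`. -/
def returnTimes {X : Type*} (T : X → X) (x : X) (U : Set X) : Set ℕ :=
  {n | T^[n] x ∈ U}

/-- `x` is a hypercyclic vector for `T`: its orbit is dense. -/
def IsHypercyclicVector {X : Type*} [TopologicalSpace X] (T : X → X) (x : X) : Prop :=
  Dense (Set.range fun n : ℕ => T^[n] x)

/-- `x` is a frequently hypercyclic vector for `T`: its orbit visits every non-empty open set
along a set of times of positive lower density. -/
def IsFrequentlyHypercyclicVector {X : Type*} [TopologicalSpace X] (T : X → X) (x : X) : Prop :=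
  ∀ U : Set X, IsOpen U → U.Nonempty → 0 < lowerDensity (returnTimes T x U)

/-- `T` is frequently hypercyclic: it has a frequently hypercyclic vector. -/
def FrequentlyHypercyclic {X : Type*} [TopologicalSpace X] (T : X → X) : Prop :=
  ∃ x : X, IsFrequentlyHypercyclicVector T x

end Dynamics

section EllOne

/-- The complex Banach space `ℓ₁(ℕ)`. -/
abbrev EllOne : Type := lp (fun _ : ℕ => ℂ) 1

/-- The canonical basis vector `e_k` of `ℓ₁(ℕ)`. -/
def e (k : ℕ) : EllOne := lp.single 1 k (1 : ℂ)

lemma norm_e (k : ℕ) : ‖e k‖ = 1 := by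
  simp [e, lp.norm_single]

lemma hasSum_norm_coord (x : EllOne) : HasSum (fun k => ‖x k‖) ‖x‖ := by
  have h := lp.hasSum_norm (p := 1) (by simp) x
  simpa using h

lemma summable_smul_col {c : ℕ → EllOne} {C : ℝ} (hC : ∀ k, ‖c k‖ ≤ C) (x : EllOne) :
    Summable fun k => ‖x k • c k‖ := by
  refine Summable.of_nonneg_of_le (fun _ => norm_nonneg _) (fun k => ?_)
    ((hasSum_norm_coord x).summable.mul_right C)
  rw [norm_smul]
  exact mul_le_mul_of_nonneg_left (hC k) (norm_nonneg _)

/-- The bounded operator on `ℓ₁(ℕ)` sending `e_k` to `c_k`, for a bounded sequence `(c_k)`. -/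
def ofColumns (c : ℕ → EllOne) (hc : ∃ C : ℝ, ∀ k, ‖c k‖ ≤ C) : EllOne →L[ℂ] EllOne :=
  LinearMap.mkContinuousOfExistsBound
    { toFun := fun x => ∑' k, x k • c k
      map_add' := fun x y => by
        obtain ⟨C, hC⟩ := hc
        rw [← (summable_smul_col hC x).of_norm.tsum_add (summable_smul_col hC y).of_norm]
        simp [add_smul]
      map_smul' := fun a x => by
        obtain ⟨C, hC⟩ := hc
        rw [RingHom.id_apply, ← (summable_smul_col hC x).of_norm.tsum_const_smul a]
        simp [smul_smul] }
    (by
      obtain ⟨C, hC⟩ := hc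
      refine ⟨C, fun x => ?_⟩
      refine tsum_of_norm_bounded ((hasSum_norm_coord x).mul_left C) (fun k => ?_)
      rw [norm_smul, mul_comm]
      exact mul_le_mul_of_nonneg_right (hC k) (norm_nonneg _))

lemma ofColumns_apply (c : ℕ → EllOne) (hc : ∃ C : ℝ, ∀ k, ‖c k‖ ≤ C) (x : EllOne) :
    ofColumns c hc x = ∑' k, x k • c k := rfl

lemma ofColumns_e (c : ℕ → EllOne) (hc : ∃ C : ℝ, ∀ k, ‖c k‖ ≤ C) (k : ℕ) :
    ofColumns c hc (e k) = c k := by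
  rw [ofColumns_apply, tsum_eq_single k]
  · simp [e]
  · intro j hj
    simp [e, hj]

end EllOne

/-- The data `(v, w, φ, b)` of an operator of C-type. The values `v 0` and `w 0` play no role. -/
structure Data where
  v : ℕ → ℂ
  w : ℕ → ℂ
  φ : ℕ → ℕ
  b : ℕ → ℕ
  v_ne_zero : ∀ n, 1 ≤ n → v n ≠ 0
  v_bounded : ∃ C : ℝ, ∀ n, 1 ≤ n → ‖v n‖ ≤ C
  w_bounded : ∃ C : ℝ, ∀ j, 1 ≤ j → ‖w j‖ ≤ C
  w_bounded_below : ∃ c : ℝ, 0 < c ∧ ∀ j, 1 ≤ j → c ≤ ‖w j‖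
  φ_zero : φ 0 = 0
  φ_lt : ∀ n, 1 ≤ n → φ n < n
  φ_fiber_infinite : ∀ l, {n | φ n = l}.Infinite
  b_zero : b 0 = 0
  b_strictMono : StrictMono b
  b_dvd : ∀ n, 1 ≤ n → 2 * (b (φ n + 1) - b (φ n)) ∣ b (n + 1) - b n
  prod_bounded_below :
    ∃ c : ℝ, 0 < c ∧ ∀ n, c ≤ ∏ j ∈ Finset.Ioo (b n) (b (n + 1)), ‖w j‖

namespace Data

variable (D : Data)

/-- The product `∏_{j = b_n + 1}^{b_{n+1} - 1} w_j` of the weights of the `n`-th block. -/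
def blockProd (n : ℕ) : ℂ := ∏ j ∈ Finset.Ioo (D.b n) (D.b (n + 1)), D.w j

/-- The index `n` of the block `[b_n, b_{n+1})` containing `k`. -/
def block (k : ℕ) : ℕ := Nat.findGreatest (fun n => D.b n ≤ k) k

lemma block_eq {n k : ℕ} (h₁ : D.b n ≤ k) (h₂ : k < D.b (n + 1)) : D.block k = n := by
  have hn : n ≤ k := (D.b_strictMono.id_le n).trans h₁
  refine le_antisymm ?_ (Nat.le_findGreatest hn h₁)
  by_contra hlt
  push Not at hlt
  have h₃ : D.b (D.block k) ≤ k :=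
    Nat.findGreatest_spec (P := fun n => D.b n ≤ k) hn h₁
  have h₄ : D.b (n + 1) ≤ D.b (D.block k) := D.b_strictMono.monotone hlt
  omega

/-- The image of `e_k` under the operator of C-type. -/
def column (k : ℕ) : EllOne :=
  if k + 1 = D.b (D.block k + 1) then
    if D.block k = 0 then -((D.blockProd 0)⁻¹ • e 0)
    else D.v (D.block k) • e (D.b (D.φ (D.block k))) -
      (D.blockProd (D.block k))⁻¹ • e (D.b (D.block k))
  else D.w (k + 1) • e (k + 1)

lemma column_bounded : ∃ C : ℝ, ∀ k, ‖D.column k‖ ≤ C := by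
  obtain ⟨V, hV⟩ := D.v_bounded
  obtain ⟨W, hW⟩ := D.w_bounded
  obtain ⟨c, hc, hP⟩ := D.prod_bounded_below
  have hinv : ∀ n, ‖(D.blockProd n)⁻¹‖ ≤ c⁻¹ := fun n => by
    rw [norm_inv, blockProd, norm_prod]
    exact inv_anti₀ hc (hP n)
  have hc' : 0 ≤ c⁻¹ := inv_nonneg.2 hc.le
  refine ⟨|V| + |W| + c⁻¹, fun k => ?_⟩
  have h₁ := abs_nonneg V
  have h₂ := abs_nonneg W
  unfold column
  split_ifs with h h0
  · rw [norm_neg, norm_smul, norm_e, mul_one]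
    linarith [hinv 0]
  · refine (norm_sub_le _ _).trans ?_
    rw [norm_smul, norm_smul, norm_e, norm_e, mul_one, mul_one]
    linarith [hinv (D.block k), hV (D.block k) (Nat.one_le_iff_ne_zero.2 h0), le_abs_self V]
  · rw [norm_smul, norm_e, mul_one]
    linarith [hW (k + 1) (by omega), le_abs_self W]

/-- The operator of C-type `T_{v,w,φ,b}` on `ℓ₁(ℕ)`. -/
def operator : EllOne →L[ℂ] EllOne := ofColumns D.column D.column_bounded

/-- `T e_k = w_{k+1} e_{k+1}` for `k ∈ [b_n, b_{n+1} - 1)`. -/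
lemma operator_e_inner {n k : ℕ} (h₁ : D.b n ≤ k) (h₂ : k + 1 < D.b (n + 1)) :
    D.operator (e k) = D.w (k + 1) • e (k + 1) := by
  have hb := D.block_eq h₁ (by omega)
  rw [operator, ofColumns_e, column, hb, if_neg h₂.ne]

/-- `T e_{b_{n+1}-1} = v_n e_{b_{φ(n)}} - (∏_{j=b_n+1}^{b_{n+1}-1} w_j)⁻¹ e_{b_n}` for `n ≥ 1`. -/
lemma operator_e_last {n k : ℕ} (hn : 1 ≤ n) (hk : k + 1 = D.b (n + 1)) :
    D.operator (e k) =
      D.v n • e (D.b (D.φ n)) -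
        (∏ j ∈ Finset.Ioo (D.b n) (D.b (n + 1)), D.w j)⁻¹ • e (D.b n) := by
  have hlt := D.b_strictMono (Nat.lt_succ_self n)
  have hb : D.block k = n := D.block_eq (by simp only [Nat.succ_eq_add_one] at hlt; omega) (by omega)
  rw [operator, ofColumns_e, column, hb, if_pos hk, if_neg (by omega), blockProd]

/-- `T e_{b_1-1} = -(∏_{j=b_0+1}^{b_1-1} w_j)⁻¹ e_0`. -/
lemma operator_e_last_zero {k : ℕ} (hk : k + 1 = D.b 1) :
    D.operator (e k) = -((∏ j ∈ Finset.Ioo (D.b 0) (D.b 1), D.w j)⁻¹ • e 0) := by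
  have hb : D.block k = 0 := D.block_eq (by rw [D.b_zero]; omega) (by rw [zero_add]; omega)
  rw [operator, ofColumns_e, column, hb, if_pos hk, if_pos rfl, blockProd]

end Data

/-- The sequence `n_0 = 0`, `n_1 = 1`, `n_{k+1} = n_k + ψ₁(k)` for `k ≥ 1`. -/
def nSeq (ψ₁ : ℕ → ℕ) : ℕ → ℕ
  | 0 => 0
  | 1 => 1
  | k + 2 => nSeq ψ₁ (k + 1) + ψ₁ (k + 1)

/-- The weight at position `i ∈ [1, L)` of a block of length `L`, where `d = δ^{(ψ₂(k))}`:
`2` for `0 < i ≤ kd+2n+1`, `1` for `kd+2n+1 < i < L-3d-2n-1`, `1/2` for `L-3d-2n-1 ≤ i < L-2d`,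
`2` for `L-2d ≤ i < L-d` and `1` for `L-d ≤ i < L`. -/
def weight (k n d L i : ℕ) : ℂ :=
  if i ≤ k * d + 2 * n + 1 then 2
  else if i + (3 * d + 2 * n + 1) < L then 1
  else if i + 2 * d < L then 1 / 2
  else if i + d < L then 2
  else 1

/-- The data `(v, w, φ, b)` are given by the parameters `ψ = (ψ₁, ψ₂)`, `(δ^{(k)})`, `(τ^{(k)})`,
`(Δ^{(k)})`, which satisfy the required restrictions. All of `ψ`, `δ`, `τ` are indexed by `k ≥ 1`,
while `Δ` is indexed by `k ≥ 0`. -/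
structure Data.IsAssociated (D : Data) (ψ₁ ψ₂ δ τ Δ : ℕ → ℕ) : Prop where
  one_le_psi₁ : ∀ k, 1 ≤ k → 1 ≤ ψ₁ k
  psi₁_lt_min : ∀ k, 1 ≤ k → ψ₁ k < min (k + 1) (ψ₂ k)
  psi₂_gt : ∀ k, 1 ≤ k → ∀ j, 1 ≤ j → j < ψ₁ k → ψ₂ j < ψ₂ k
  psi_infinite : ∀ i, 1 ≤ i → ∃ j₀, ∀ j, j₀ ≤ j → {k | 1 ≤ k ∧ ψ₁ k = i ∧ ψ₂ k = j}.Infinite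
  delta_pos : ∀ k, 1 ≤ k → 0 < δ k
  delta_mono : MonotoneOn δ (Set.Ici 1)
  tau_pos : ∀ k, 1 ≤ k → 0 < τ k
  tau_mono : MonotoneOn τ (Set.Ici 1)
  Delta_zero : Δ 0 = D.b 1 - D.b 0
  Delta_dvd : ∀ k, 1 ≤ k → 2 * Δ (k - 1) ∣ Δ k
  Delta_gt : ∀ k, 1 ≤ k → (k + 3) * δ (ψ₂ k) + 4 * nSeq ψ₁ (k + 1) + 2 < Δ k
  phi_eq : ∀ k, 1 ≤ k → ∀ n ∈ Set.Ico (nSeq ψ₁ k) (nSeq ψ₁ (k + 1)), D.φ n = n - nSeq ψ₁ k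
  v_eq : ∀ k, 1 ≤ k → ∀ n ∈ Set.Ico (nSeq ψ₁ k) (nSeq ψ₁ (k + 1)),
    D.v n = (2 : ℂ) ^ (-(τ (ψ₂ k) : ℤ))
  b_eq : ∀ k, 1 ≤ k → ∀ n ∈ Set.Ico (nSeq ψ₁ k) (nSeq ψ₁ (k + 1)), D.b (n + 1) - D.b n = Δ k
  w_eq : ∀ k, 1 ≤ k → ∀ n ∈ Set.Ico (nSeq ψ₁ k) (nSeq ψ₁ (k + 1)), ∀ i ∈ Set.Ico 1 (Δ k),
    D.w (D.b n + i) = weight k n (δ (ψ₂ k)) (Δ k) i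

/-- `γ_k = 2^{k δ^{(k-1)} + 2 n_k + 1 - τ^{(k)}}`, for `k ≥ 1`. -/
def gammaSeq (ψ₁ δ τ : ℕ → ℕ) (k : ℕ) : ℝ :=
  (2 : ℝ) ^ ((k : ℤ) * (δ (k - 1) : ℤ) + 2 * (nSeq ψ₁ k : ℤ) + 1 - (τ k : ℤ))

end CType

end

/-! ### Orbits of the basis vectors `e (b n)` -/

namespace CType

/-! In coordinates normalised by the partial products of the weights, `T` turns each block
cyclically up to signs, and every other turn of block `m` also leaks a multiple of the orbit of `e
(b (φ m))` into lower blocks (`operator_pow_eq`). The actual size of what block `n` carries is its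
`mass` times the partial product at the current place, which equals `height n` except on a short
stretch at each end of the block.

Let `A = height n * mass n x`, with `‖x‖ ≤ 2 * A`. As long as the leaks from other blocks stay below
half of `mass n x`, the orbit has norm at least `A / 4`, except when a quarter of the mass sits on
those end stretches; averaging over the rotation makes such times rare. A dense orbit comes near
`0`, so there is a first time `J` at which the leaks are larger. Since `v` is small enough to kill
the height of the receiving block, this requires a block `m` with `n ≤ φ m` and `height m * mass m x
≥ A`. It also requires `J > d m`, because before that time only the flat tail of block `m` can have
leaked (`Profile.exists_height_mul_mass_ge`).

Starting again from `m`, with the same `x`, gives infinitely many blocks with the same lower bound.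
The growth conditions make the end stretches negligible against both `len n` and `d m < J`, so the
proportion of small times before `J` tends to `0` (`Profile.exists_card_le`). Hence the orbit stays
outside some ball with upper density one, and visits that ball with lower density zero. -/

lemma e_apply (k j : ℕ) : (e k : EllOne) j = if j = k then 1 else 0 := by
  by_cases h : j = k
  · subst h; simp [e]
  · simp [e, h]

namespace Data

variable (D : Data)

/-- The length of the `n`-th block. -/
def len (n : ℕ) : ℕ := D.b (n + 1) - D.b n

/-- The product of the first `i` weights of the `n`-th block. -/
noncomputable def partialProd (n i : ℕ) : ℂ := ∏ j ∈ Finset.range i, D.w (D.b n + 1 + j)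

/-- The coefficient with which the `n`-th block leaks into the block `φ n`. -/
noncomputable def leak (n : ℕ) : ℂ := if n = 0 then 0 else D.v n

lemma b_succ (n : ℕ) : D.b (n + 1) = D.b n + D.len n := by
  have := D.b_strictMono (Nat.lt_succ_self n)
  simp only [Nat.succ_eq_add_one] at this
  unfold len; omega

lemma len_pos (n : ℕ) : 0 < D.len n := by
  have := D.b_strictMono (Nat.lt_succ_self n)
  simp only [Nat.succ_eq_add_one] at this
  unfold len; omega

lemma w_ne_zero {j : ℕ} (hj : 1 ≤ j) : D.w j ≠ 0 := by
  obtain ⟨c, hc, h⟩ := D.w_bounded_below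
  exact norm_pos_iff.1 (hc.trans_le (h j hj))

lemma partialProd_ne_zero (n i : ℕ) : D.partialProd n i ≠ 0 :=
  Finset.prod_ne_zero_iff.2 fun _ _ => D.w_ne_zero (by omega)

lemma partialProd_succ (n i : ℕ) :
    D.partialProd n (i + 1) = D.partialProd n i * D.w (D.b n + (i + 1)) := by
  rw [partialProd, Finset.prod_range_succ, partialProd, add_assoc, add_comm 1 i]

lemma blockProd_eq_partialProd (n : ℕ) : D.blockProd n = D.partialProd n (D.len n - 1) := by
  rw [blockProd, partialProd, len, show Finset.Ioo (D.b n) (D.b (n + 1)) =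
    Finset.Ico (D.b n + 1) (D.b (n + 1)) by ext; simp, Finset.prod_Ico_eq_prod_range,
    Nat.sub_sub]

lemma blockProd_ne_zero (n : ℕ) : D.blockProd n ≠ 0 := by
  rw [blockProd_eq_partialProd]; exact D.partialProd_ne_zero _ _

lemma operator_pow_e {n i : ℕ} (hi : i < D.len n) :
    (D.operator ^ i) (e (D.b n)) = D.partialProd n i • e (D.b n + i) := by
  induction i with
  | zero => simp [partialProd]
  | succ i ih =>
    have hb := D.b_succ n
    rw [pow_succ', mul_apply_eq_comp, ih (by omega), map_smul,
      D.operator_e_inner (n := n) (by omega) (by omega), smul_smul, partialProd_succ]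
    rfl

lemma operator_last (n : ℕ) :
    D.operator (e (D.b n + (D.len n - 1))) =
      D.leak n • e (D.b (D.φ n)) - (D.blockProd n)⁻¹ • e (D.b n) := by
  have hb := D.b_succ n
  have hl := D.len_pos n
  rcases Nat.eq_zero_or_pos n with rfl | hn
  · rw [zero_add] at hb
    rw [D.operator_e_last_zero (by omega), leak, if_pos rfl, zero_smul, zero_sub, D.b_zero]
    simp [blockProd, D.b_zero]
  · rw [D.operator_e_last hn (by omega), leak, if_neg (by omega), blockProd]

/-- The coefficient of the last step cancels the product of the weights, so a full turn leaves only
a sign change and the leak. -/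
lemma operator_pow_len (n : ℕ) :
    (D.operator ^ D.len n) (e (D.b n)) =
      (D.blockProd n * D.leak n) • e (D.b (D.φ n)) - e (D.b n) := by
  have hl := D.len_pos n
  obtain ⟨l, hl'⟩ : ∃ l, D.len n = l + 1 := ⟨D.len n - 1, by omega⟩
  have h := D.operator_pow_e (n := n) (i := D.len n - 1) (by omega)
  have h2 := D.operator_last n
  rw [← blockProd_eq_partialProd] at h
  rw [show D.operator ^ D.len n = D.operator * D.operator ^ (D.len n - 1) by
    rw [← pow_succ']; congr 1; omega, mul_apply_eq_comp, h, map_smul, h2, smul_sub,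
    smul_smul, smul_smul, mul_inv_cancel₀ (D.blockProd_ne_zero n), one_smul]

lemma two_len_dvd {n : ℕ} (hn : 1 ≤ n) : 2 * D.len (D.φ n) ∣ D.len n := D.b_dvd n hn

/-- By induction along `φ`, the vector leaked in the first turn is fixed by `T ^ len n`, because `2
* len (φ n) ∣ len n`. The second turn, with its opposite sign, leaks the same vector and cancels it.
-/
lemma operator_pow_of_dvd (n : ℕ) :
    ∀ t, 2 * D.len n ∣ t → (D.operator ^ t) (e (D.b n)) = e (D.b n) := by
  induction n using Nat.strong_induction_on with
  | _ n ih =>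
    have key : (D.operator ^ (2 * D.len n)) (e (D.b n)) = e (D.b n) := by
      have h0 : (D.blockProd n * D.leak n) • (D.operator ^ D.len n) (e (D.b (D.φ n))) =
          (D.blockProd n * D.leak n) • e (D.b (D.φ n)) := by
        rcases Nat.eq_zero_or_pos n with rfl | hn
        · simp [leak]
        · rw [ih _ (D.φ_lt n hn) _ (D.two_len_dvd hn)]
      rw [two_mul, pow_add, mul_apply_eq_comp, operator_pow_len, map_sub, map_smul, h0,
        operator_pow_len, sub_sub_cancel]
    rintro t ⟨q, rfl⟩
    induction q with
    | zero => simp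
    | succ q ihq =>
      rw [mul_add, mul_one, pow_add, mul_apply_eq_comp, key, ihq]

/-- The orbit of `e_{b_n}` runs around the `n`-th block and, during every other turn, also
follows the orbit of `e_{b_{φ(n)}}`. -/
lemma operator_pow_eq (n t : ℕ) : ∃ ε χ : ℂ, ‖ε‖ = 1 ∧ ‖χ‖ ≤ 1 ∧ (t < D.len n → χ = 0) ∧
    (D.operator ^ t) (e (D.b n)) =
      (ε * D.partialProd n (t % D.len n)) • e (D.b n + t % D.len n) +
      (χ * (D.blockProd n * D.leak n)) • (D.operator ^ t) (e (D.b (D.φ n))) := by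
  have hs : t % D.len n < D.len n := Nat.mod_lt _ (D.len_pos n)
  have ht : t = t % D.len n + D.len n * (t / D.len n) := (Nat.mod_add_div _ _).symm
  rcases Nat.even_or_odd' (t / D.len n) with ⟨q, hq | hq⟩
  · refine ⟨1, 0, by simp, by simp, fun _ => rfl, ?_⟩
    rw [zero_mul, zero_smul, add_zero, one_mul]
    conv_lhs => rw [ht, hq, pow_add, mul_apply_eq_comp]
    rw [D.operator_pow_of_dvd n _ ⟨q, by ring⟩, D.operator_pow_e hs]
  · refine ⟨-1, 1, by simp, by simp, fun h => ?_, ?_⟩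
    · rw [Nat.div_eq_of_lt h] at hq; omega
    have h1 : (D.operator ^ (D.len n * (t / D.len n))) (e (D.b n)) =
        (D.blockProd n * D.leak n) • e (D.b (D.φ n)) - e (D.b n) := by
      rw [hq, mul_add, mul_one, add_comm, pow_add, mul_apply_eq_comp,
        D.operator_pow_of_dvd n _ ⟨q, by ring⟩, operator_pow_len]
    -- Whole turns of block `n` are multiples of the period of `e (b (φ n))`, so the leaked vector
    -- sits where its own orbit would be at time `t`.
    have h2 : (D.blockProd n * D.leak n) • (D.operator ^ t) (e (D.b (D.φ n))) =
        (D.blockProd n * D.leak n) • (D.operator ^ (t % D.len n)) (e (D.b (D.φ n))) := by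
      rcases Nat.eq_zero_or_pos n with rfl | hn
      · simp [leak]
      · conv_lhs => rw [ht, pow_add, mul_apply_eq_comp,
          D.operator_pow_of_dvd (D.φ n) _ ((D.two_len_dvd hn).mul_right _)]
    rw [one_mul, h2]
    conv_lhs => rw [ht, pow_add, mul_apply_eq_comp, h1, map_sub, map_smul,
      D.operator_pow_e hs]
    rw [neg_one_mul, neg_smul, sub_eq_add_neg, add_comm]

end Data
end CType

/-! ### Block masses and the influence of one block on another -/

namespace CType

lemma add_apply' (x y : EllOne) (k : ℕ) : (x + y) k = x k + y k := rfl

lemma sub_apply' (x y : EllOne) (k : ℕ) : (x - y) k = x k - y k := rfl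

lemma smul_apply' (a : ℂ) (x : EllOne) (k : ℕ) : (a • x) k = a * x k := rfl

lemma sum_norm_coord_le (x : EllOne) (s : Finset ℕ) : ∑ k ∈ s, ‖x k‖ ≤ ‖x‖ :=
  sum_le_hasSum s (fun _ _ => norm_nonneg _) (hasSum_norm_coord x)

lemma norm_coord_le (x : EllOne) (k : ℕ) : ‖x k‖ ≤ ‖x‖ := by
  simpa using sum_norm_coord_le x {k}

lemma continuous_coord (k : ℕ) : Continuous fun x : EllOne => x k :=
  (lp.evalCLM ℂ (fun _ : ℕ => ℂ) 1 k).continuous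

lemma hasSum_smul_e (x : EllOne) : HasSum (fun k => x k • e k) x := by
  have h := lp.hasSum_single (p := 1) (by simp) x
  convert h using 2 with k
  rw [e, ← lp.single_smul]
  simp

namespace Data

variable (D : Data)

/-- The `ℓ₁`-mass of the `n`-th block of `y`, in the coordinates in which the operator acts on the
block as a cyclic shift. -/
noncomputable def mass (n : ℕ) (y : EllOne) : ℝ :=
  ∑ i ∈ Finset.range (D.len n), ‖y (D.b n + i)‖ / ‖D.partialProd n i‖

lemma mass_nonneg (n : ℕ) (y : EllOne) : 0 ≤ D.mass n y :=
  Finset.sum_nonneg fun _ _ => by positivity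

lemma mass_zero (n : ℕ) : D.mass n 0 = 0 := by
  simp [mass]

lemma mass_add_le (n : ℕ) (x y : EllOne) : D.mass n (x + y) ≤ D.mass n x + D.mass n y := by
  rw [mass, mass, mass, ← Finset.sum_add_distrib]
  refine Finset.sum_le_sum fun i _ => ?_
  rw [← add_div]
  exact div_le_div_of_nonneg_right (norm_add_le _ _) (norm_nonneg _)

lemma mass_smul (n : ℕ) (a : ℂ) (x : EllOne) : D.mass n (a • x) = ‖a‖ * D.mass n x := by
  rw [mass, mass, Finset.mul_sum]
  refine Finset.sum_congr rfl fun i _ => ?_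
  rw [smul_apply', norm_mul, mul_div_assoc]

lemma mass_sum_le {ι : Type*} (n : ℕ) (s : Finset ι) (f : ι → EllOne) :
    D.mass n (∑ i ∈ s, f i) ≤ ∑ i ∈ s, D.mass n (f i) :=
  Finset.le_sum_of_subadditive _ (D.mass_zero n).le (D.mass_add_le n) s f

lemma continuous_mass (n : ℕ) : Continuous (D.mass n) :=
  continuous_finsetSum _ fun _ _ => (continuous_coord _).norm.div_const _

lemma b_add_injective {m n i i' : ℕ} (hi : i < D.len m) (hi' : i' < D.len n)
    (h : D.b m + i = D.b n + i') : m = n ∧ i = i' := by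
  have h1 := D.b_succ m
  have h2 := D.b_succ n
  have h3 := D.block_eq (n := m) (k := D.b m + i) (by omega) (by omega)
  have h4 := D.block_eq (n := n) (k := D.b m + i) (by omega) (by omega)
  obtain rfl := h3.symm.trans h4
  exact ⟨rfl, by omega⟩

lemma mass_e {m n i : ℕ} (hi : i < D.len m) (hmn : m ≠ n) : D.mass n (e (D.b m + i)) = 0 := by
  refine Finset.sum_eq_zero fun i' hi' => ?_
  rw [e_apply, if_neg, norm_zero, zero_div]
  exact fun h => hmn (D.b_add_injective (Finset.mem_range.1 hi') hi h).1.symm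

lemma mass_orbit_le_leak {m n : ℕ} (hmn : m ≠ n) (t : ℕ) :
    D.mass n ((D.operator ^ t) (e (D.b m))) ≤
      if D.len m ≤ t then
        ‖D.blockProd m * D.leak m‖ * D.mass n ((D.operator ^ t) (e (D.b (D.φ m)))) else 0 := by
  obtain ⟨ε, χ, -, hχ, h0, h⟩ := D.operator_pow_eq m t
  have hs : t % D.len m < D.len m := Nat.mod_lt _ (D.len_pos m)
  have h1 : D.mass n ((D.operator ^ t) (e (D.b m))) ≤
      ‖χ‖ * ‖D.blockProd m * D.leak m‖ * D.mass n ((D.operator ^ t) (e (D.b (D.φ m)))) := by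
    rw [h]
    refine (D.mass_add_le _ _ _).trans ?_
    rw [mass_smul, mass_smul, D.mass_e hs hmn, mul_zero, zero_add, norm_mul χ]
  split_ifs with hl
  · refine h1.trans (mul_le_mul_of_nonneg_right ?_ (D.mass_nonneg _ _))
    exact mul_le_of_le_one_left (norm_nonneg _) hχ
  · simpa [h0 (by omega)] using h1

/-- Leaks only go down, since `φ m < m`, and block `0` does not leak. -/
lemma mass_orbit_of_lt {m n : ℕ} (hmn : m < n) (t : ℕ) :
    D.mass n ((D.operator ^ t) (e (D.b m))) = 0 := by
  induction m using Nat.strong_induction_on with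
  | _ m ih =>
    refine le_antisymm ((D.mass_orbit_le_leak hmn.ne t).trans ?_) (D.mass_nonneg _ _)
    split_ifs with hl
    · rcases Nat.eq_zero_or_pos m with rfl | hm
      · simp [leak]
      · have := D.φ_lt m hm
        rw [ih _ this (by omega), mul_zero]
    · exact le_rfl

lemma coord_eq_zero_of_mass_eq_zero {n i : ℕ} {y : EllOne} (hi : i < D.len n)
    (h : D.mass n y = 0) : y (D.b n + i) = 0 := by
  have := (Finset.sum_eq_zero_iff_of_nonneg (fun _ _ => by positivity)).1 h i
    (Finset.mem_range.2 hi)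
  rcases div_eq_zero_iff.1 this with h | h
  · exact norm_eq_zero.1 h
  · exact absurd (norm_eq_zero.1 h) (D.partialProd_ne_zero n i)

lemma coord_orbit_self (n t : ℕ) : ∃ ε : ℂ, ‖ε‖ = 1 ∧ ∀ i < D.len n,
    ((D.operator ^ t) (e (D.b n))) (D.b n + i) =
      if i = t % D.len n then ε * D.partialProd n i else 0 := by
  obtain ⟨ε, χ, hε, -, -, h⟩ := D.operator_pow_eq n t
  refine ⟨ε, hε, fun i hi => ?_⟩
  have h0 : (χ * (D.blockProd n * D.leak n)) *
      ((D.operator ^ t) (e (D.b (D.φ n)))) (D.b n + i) = 0 := by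
    rcases Nat.eq_zero_or_pos n with rfl | hn
    · simp [leak]
    · rw [D.coord_eq_zero_of_mass_eq_zero hi (D.mass_orbit_of_lt (D.φ_lt n hn) t), mul_zero]
  rw [h, add_apply', smul_apply', smul_apply', h0, add_zero, e_apply]
  by_cases hit : i = t % D.len n
  · rw [if_pos (by rw [hit]), if_pos hit, mul_one, hit]
  · rw [if_neg (by omega), if_neg hit, mul_zero]

lemma mass_orbit_self (n t : ℕ) : D.mass n ((D.operator ^ t) (e (D.b n))) = 1 := by
  obtain ⟨ε, hε, h⟩ := D.coord_orbit_self n t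
  have hs : t % D.len n < D.len n := Nat.mod_lt _ (D.len_pos n)
  rw [mass, Finset.sum_eq_single_of_mem _ (Finset.mem_range.2 hs), h _ hs, if_pos rfl, norm_mul,
    hε, one_mul, div_self (norm_ne_zero_iff.2 (D.partialProd_ne_zero _ _))]
  intro i hi hne
  rw [h i (Finset.mem_range.1 hi), if_neg hne, norm_zero, zero_div]

/-- The largest modulus of the partial products in the `n`-th block. -/
noncomputable def height (n : ℕ) : ℝ := 2 ^ (2 * n + 1) * ‖D.blockProd n‖

lemma height_pos (n : ℕ) : 0 < D.height n :=
  mul_pos (by positivity) (norm_pos_iff.2 (D.blockProd_ne_zero n))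

/-- The shape of the weights of the blocks: the partial products of the `n`-th block have their
maximal modulus at a distance at least `lo n` from the start and more than `hi n` from the end,
and are constant on the last `d n` places; what leaks out of a block is small. -/
structure Profile (d lo hi : ℕ → ℕ) : Prop where
  top : ∀ n, 1 ≤ n → ∀ i, lo n ≤ i → i + hi n < D.len n → ‖D.partialProd n i‖ = D.height n
  tail : ∀ n, 1 ≤ n → ∀ i, i < D.len n → D.len n ≤ i + d n →
    ‖D.partialProd n i‖ = ‖D.blockProd n‖
  lo_add_hi_lt : ∀ n, 1 ≤ n → lo n + hi n < D.len n
  leak_le : ∀ n, 1 ≤ n → 1 ≤ D.φ n → ‖D.v n‖ * D.height (D.φ n) ≤ 2⁻¹ ^ 16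

variable {D} {d lo hi : ℕ → ℕ}

/-- Block `n` sees only what descends from `φ m`, and by induction this amounts to at most `height
(φ m)`. The factor `v m` makes that height small, and a leak requires a completed turn of block `m`.
-/
lemma Profile.height_mul_mass_orbit_le (hP : D.Profile d lo hi) {m n : ℕ} (hn : 1 ≤ n)
    (hmn : m ≠ n) (t : ℕ) :
    D.height n * D.mass n ((D.operator ^ t) (e (D.b m))) ≤
      if D.len m ≤ t ∧ n ≤ D.φ m then 2⁻¹ ^ 16 * ‖D.blockProd m‖ else 0 := by
  induction m using Nat.strong_induction_on with
  | _ m ih =>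
    have h := D.mass_orbit_le_leak hmn t
    split_ifs with hc
    · obtain ⟨h1, h2⟩ := hc
      have hm : 1 ≤ m := by
        rcases Nat.eq_zero_or_pos m with rfl | hm
        · rw [D.φ_zero] at h2; omega
        · exact hm
      rw [if_pos h1, norm_mul, leak, if_neg (by omega)] at h
      have h3 : D.height n * D.mass n ((D.operator ^ t) (e (D.b (D.φ m)))) ≤
          D.height (D.φ m) := by
        by_cases hφ : D.φ m = n
        · rw [hφ, mass_orbit_self, mul_one]
        · refine (ih _ (D.φ_lt m hm) hφ).trans ?_
          split_ifs
          · refine mul_le_mul_of_nonneg_right ?_ (norm_nonneg _)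
            calc (2⁻¹ : ℝ) ^ 16 ≤ 1 := by norm_num
              _ ≤ _ := one_le_pow₀ (by norm_num)
          · exact (D.height_pos _).le
      calc _ ≤ D.height n * (‖D.blockProd m‖ * ‖D.v m‖ *
            D.mass n ((D.operator ^ t) (e (D.b (D.φ m))))) :=
          mul_le_mul_of_nonneg_left h (D.height_pos n).le
        _ = ‖D.blockProd m‖ * ‖D.v m‖ * (D.height n *
            D.mass n ((D.operator ^ t) (e (D.b (D.φ m))))) := by ring
        _ ≤ ‖D.blockProd m‖ * ‖D.v m‖ * D.height (D.φ m) :=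
          mul_le_mul_of_nonneg_left h3 (by positivity)
        _ = ‖D.v m‖ * D.height (D.φ m) * ‖D.blockProd m‖ := by ring
        _ ≤ _ := mul_le_mul_of_nonneg_right (hP.leak_le m hm (by omega)) (norm_nonneg _)
    · have h0 : D.mass n ((D.operator ^ t) (e (D.b m))) ≤ 0 := by
        refine h.trans ?_
        split_ifs with h1
        · rw [D.mass_orbit_of_lt (not_le.1 fun h2 => hc ⟨h1, h2⟩), mul_zero]
        · exact le_rfl
      exact mul_nonpos_of_nonneg_of_nonpos (D.height_pos n).le h0

variable (D) in
/-- The restriction of `x` to the `n`-th block. -/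
noncomputable def proj (n : ℕ) (x : EllOne) : EllOne :=
  ∑ i ∈ Finset.range (D.len n), x (D.b n + i) • e (D.b n + i)

lemma operator_pow_proj (n t : ℕ) (x : EllOne) :
    (D.operator ^ t) (D.proj n x) = ∑ i ∈ Finset.range (D.len n),
      (x (D.b n + i) / D.partialProd n i) • (D.operator ^ (t + i)) (e (D.b n)) := by
  rw [proj, map_sum]
  refine Finset.sum_congr rfl fun i hi => ?_
  rw [pow_add, mul_apply_eq_comp, D.operator_pow_e (Finset.mem_range.1 hi), map_smul, map_smul,
    smul_smul, div_mul_cancel₀ _ (D.partialProd_ne_zero _ _)]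

lemma sum_range_b {M : Type*} [AddCommMonoid M] (f : ℕ → M) (N : ℕ) :
    ∑ k ∈ Finset.range (D.b N), f k =
      ∑ m ∈ Finset.range N, ∑ i ∈ Finset.range (D.len m), f (D.b m + i) := by
  induction N with
  | zero => simp [D.b_zero]
  | succ N ih => rw [Finset.sum_range_succ, ← ih, b_succ, Finset.sum_range_add]

lemma tendsto_sum_proj (x : EllOne) :
    Tendsto (fun N => ∑ m ∈ Finset.range N, D.proj m x) atTop (𝓝 x) := by
  have h := (hasSum_smul_e x).tendsto_sum_nat.comp D.b_strictMono.tendsto_atTop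
  refine h.congr fun N => ?_
  exact D.sum_range_b _ N

lemma sum_norm_proj_le (x : EllOne) (N : ℕ) :
    ∑ m ∈ Finset.range N, ∑ i ∈ Finset.range (D.len m), ‖x (D.b m + i)‖ ≤ ‖x‖ := by
  rw [← D.sum_range_b fun k => ‖x k‖]
  exact sum_norm_coord_le x _

/-- Two regimes. If `t ≤ d m`, only places in the flat tail have passed the end of block `m`; there
the partial product equals `blockProd m`, so the leak is controlled by the norm of `x` on the block.
If `d m < t`, the bound `A` applies, and the factor `2 ^ (2 * m + 1)` in `height m` makes the
estimate summable in `m`. -/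
lemma Profile.height_mul_mass_proj_le (hP : D.Profile d lo hi) {m n : ℕ} (hn : 1 ≤ n)
    (hmn : m ≠ n) (t : ℕ) (x : EllOne) {A : ℝ} (hA : 0 ≤ A)
    (h : n ≤ D.φ m → d m < t → D.height m * D.mass m x ≤ A) :
    D.height n * D.mass n ((D.operator ^ t) (D.proj m x)) ≤
      2⁻¹ ^ 16 * ((∑ i ∈ Finset.range (D.len m), ‖x (D.b m + i)‖) + (1 / 2) ^ m * A) := by
  have h1 : D.height n * D.mass n ((D.operator ^ t) (D.proj m x)) ≤
      ∑ i ∈ Finset.range (D.len m), ‖x (D.b m + i)‖ / ‖D.partialProd m i‖ *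
        if D.len m ≤ t + i ∧ n ≤ D.φ m then 2⁻¹ ^ 16 * ‖D.blockProd m‖ else 0 := by
    rw [operator_pow_proj]
    refine (mul_le_mul_of_nonneg_left (D.mass_sum_le n _ _) (D.height_pos n).le).trans ?_
    rw [Finset.mul_sum]
    refine Finset.sum_le_sum fun i _ => ?_
    rw [mass_smul, norm_div, mul_left_comm]
    exact mul_le_mul_of_nonneg_left (hP.height_mul_mass_orbit_le hn hmn _) (by positivity)
  refine h1.trans ?_
  by_cases hφ : n ≤ D.φ m
  swap
  · simp only [hφ, and_false, if_false, mul_zero, Finset.sum_const_zero]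
    positivity
  have hm : 1 ≤ m := by
    rcases Nat.eq_zero_or_pos m with rfl | hm
    · rw [D.φ_zero] at hφ; omega
    · exact hm
  by_cases hd : d m < t
  · have h2 : ‖D.blockProd m‖ * D.mass m x ≤ (1 / 2) ^ m * A := by
      have h3 : D.height m * D.mass m x ≤ A := h hφ hd
      have h4 : D.height m = 2 * 2 ^ m * (2 ^ m * ‖D.blockProd m‖) := by
        rw [height]; ring
      have h5 := D.mass_nonneg m x
      have h6 : (1 : ℝ) ≤ 2 ^ m := one_le_pow₀ (by norm_num)
      rw [one_div, inv_pow, inv_mul_eq_div, le_div_iff₀ (by positivity)]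
      have h7 : 0 ≤ 2 ^ m * ‖D.blockProd m‖ * D.mass m x := by positivity
      rw [h4] at h3
      nlinarith
    calc _ ≤ ∑ i ∈ Finset.range (D.len m), ‖x (D.b m + i)‖ / ‖D.partialProd m i‖ *
          (2⁻¹ ^ 16 * ‖D.blockProd m‖) := by
          refine Finset.sum_le_sum fun i _ => mul_le_mul_of_nonneg_left ?_ (by positivity)
          split_ifs
          · exact le_rfl
          · positivity
      _ = 2⁻¹ ^ 16 * (‖D.blockProd m‖ * D.mass m x) := by rw [← Finset.sum_mul, mass]; ring
      _ ≤ 2⁻¹ ^ 16 * ((1 / 2) ^ m * A) := mul_le_mul_of_nonneg_left h2 (by positivity)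
      _ ≤ _ := by
          refine mul_le_mul_of_nonneg_left ?_ (by positivity)
          exact le_add_of_nonneg_left (Finset.sum_nonneg fun _ _ => norm_nonneg _)
  · calc _ ≤ ∑ i ∈ Finset.range (D.len m), 2⁻¹ ^ 16 * ‖x (D.b m + i)‖ := by
          refine Finset.sum_le_sum fun i hi => ?_
          split_ifs with hc
          · rw [hP.tail m hm i (Finset.mem_range.1 hi) (by omega)]
            have := norm_pos_iff.2 (D.blockProd_ne_zero m)
            rw [mul_left_comm, div_mul_cancel₀ _ this.ne']
          · rw [mul_zero]; positivity
      _ = 2⁻¹ ^ 16 * ∑ i ∈ Finset.range (D.len m), ‖x (D.b m + i)‖ := by rw [Finset.mul_sum]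
      _ ≤ _ := by
          refine mul_le_mul_of_nonneg_left ?_ (by positivity)
          exact le_add_of_nonneg_right (by positivity)

/-- If the other blocks of `x` have at time `t` a notable influence on the `n`-th block, then one
of them is at least as large as the `n`-th block. -/
lemma Profile.exists_height_mul_mass_ge (hP : D.Profile d lo hi) {n : ℕ} (hn : 1 ≤ n) {t : ℕ}
    {x : EllOne} (hx : ‖x‖ ≤ 2 * (D.height n * D.mass n x))
    (hpos : 0 < D.height n * D.mass n x)
    (ht : D.height n * D.mass n x / 2 <
      D.height n * D.mass n ((D.operator ^ t) (x - D.proj n x))) :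
    ∃ m, n ≤ D.φ m ∧ d m < t ∧ D.height n * D.mass n x ≤ D.height m * D.mass m x := by
  by_contra! hcon
  set A := D.height n * D.mass n x with hA
  have hlim : Tendsto (fun N => D.height n * D.mass n ((D.operator ^ t)
      ((∑ m ∈ Finset.range N, D.proj m x) - D.proj n x))) atTop
      (𝓝 (D.height n * D.mass n ((D.operator ^ t) (x - D.proj n x)))) := by
    refine Tendsto.const_mul _ ?_
    refine ((D.continuous_mass n).tendsto _).comp ?_
    exact (((D.operator ^ t).continuous.tendsto _).comp ((tendsto_sum_proj x).sub_const _))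
  have hle : ∀ᶠ N in atTop, D.height n * D.mass n ((D.operator ^ t)
      ((∑ m ∈ Finset.range N, D.proj m x) - D.proj n x)) ≤ 2⁻¹ ^ 16 * (‖x‖ + 2 * A) := by
    filter_upwards [eventually_gt_atTop n] with N hN
    rw [← Finset.add_sum_erase _ _ (Finset.mem_range.2 hN), add_sub_cancel_left, map_sum]
    calc _ ≤ ∑ m ∈ (Finset.range N).erase n,
          D.height n * D.mass n ((D.operator ^ t) (D.proj m x)) := by
          rw [← Finset.mul_sum]
          exact mul_le_mul_of_nonneg_left (D.mass_sum_le n _ _) (D.height_pos n).le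
      _ ≤ ∑ m ∈ (Finset.range N).erase n, 2⁻¹ ^ 16 *
          ((∑ i ∈ Finset.range (D.len m), ‖x (D.b m + i)‖) + (1 / 2) ^ m * A) :=
          Finset.sum_le_sum fun m hm => hP.height_mul_mass_proj_le hn (Finset.ne_of_mem_erase hm) t
            x hpos.le fun h1 h2 => (hcon m h1 h2).le
      _ ≤ ∑ m ∈ Finset.range N, 2⁻¹ ^ 16 *
          ((∑ i ∈ Finset.range (D.len m), ‖x (D.b m + i)‖) + (1 / 2) ^ m * A) :=
          Finset.sum_le_sum_of_subset_of_nonneg (Finset.erase_subset _ _) fun _ _ _ => by positivity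
      _ ≤ _ := by
          rw [← Finset.mul_sum, Finset.sum_add_distrib, ← Finset.sum_mul]
          refine mul_le_mul_of_nonneg_left (add_le_add (sum_norm_proj_le x N)
            (mul_le_mul_of_nonneg_right (sum_geometric_two_le N) hpos.le)) (by positivity)
  have := le_of_tendsto hlim hle
  -- As `‖x‖ ≤ 2 * A`, all the leaks together are at most `4 * A / 65536`, below `A / 2`.
  rw [show (2⁻¹ : ℝ) ^ 16 = 1 / 65536 by norm_num] at this
  linarith

lemma norm_coord_operator_pow_proj (n t : ℕ) (x : EllOne) {i : ℕ} (hi : i < D.len n) :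
    ‖((D.operator ^ t) (D.proj n x)) (D.b n + (t + i) % D.len n)‖ =
      ‖x (D.b n + i)‖ / ‖D.partialProd n i‖ * ‖D.partialProd n ((t + i) % D.len n)‖ := by
  have hs : (t + i) % D.len n < D.len n := Nat.mod_lt _ (D.len_pos n)
  rw [operator_pow_proj, ← lp.coeFnAddMonoidHom_apply, map_sum, Finset.sum_apply,
    Finset.sum_eq_single_of_mem i (Finset.mem_range.2 hi)]
  · obtain ⟨ε, hε, h⟩ := D.coord_orbit_self n (t + i)
    rw [lp.coeFnAddMonoidHom_apply, smul_apply', h _ hs, if_pos rfl, norm_mul, norm_mul, hε,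
      one_mul, norm_div]
  · intro i' hi' hne
    obtain ⟨ε, hε, h⟩ := D.coord_orbit_self n (t + i')
    rw [lp.coeFnAddMonoidHom_apply, smul_apply', h _ hs, if_neg, mul_zero]
    intro hmod
    have : i ≡ i' [MOD D.len n] := Nat.ModEq.add_left_cancel' t hmod
    exact hne (this.eq_of_lt_of_lt hi (Finset.mem_range.1 hi')).symm

lemma add_mod_injOn (t n : ℕ) :
    Set.InjOn (fun i => (t + i) % D.len n) (Finset.range (D.len n)) := by
  intro i hi i' hi' h
  have : i ≡ i' [MOD D.len n] := Nat.ModEq.add_left_cancel' t h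
  exact this.eq_of_lt_of_lt (by simpa using hi) (by simpa using hi')

/-- The mass on `F` is carried unchanged to the rotated places, and the other blocks can cancel at
most their own mass there. -/
lemma sum_mass_sub_le (n t : ℕ) (x : EllOne) {F : Finset ℕ} (hF : F ⊆ Finset.range (D.len n)) :
    ∑ i ∈ F, ‖x (D.b n + i)‖ / ‖D.partialProd n i‖ -
        D.mass n ((D.operator ^ t) (x - D.proj n x)) ≤
      ∑ i ∈ F, ‖((D.operator ^ t) x) (D.b n + (t + i) % D.len n)‖ /
        ‖D.partialProd n ((t + i) % D.len n)‖ := by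
  set y := (D.operator ^ t) (x - D.proj n x) with hy
  have h1 : ∑ i ∈ F, ‖y (D.b n + (t + i) % D.len n)‖ / ‖D.partialProd n ((t + i) % D.len n)‖ ≤
      D.mass n y := by
    rw [mass, ← Finset.sum_image (g := fun i => (t + i) % D.len n)
      (f := fun i => ‖y (D.b n + i)‖ / ‖D.partialProd n i‖)
      ((add_mod_injOn t n).mono (by exact_mod_cast hF))]
    refine Finset.sum_le_sum_of_subset_of_nonneg ?_ fun _ _ _ => by positivity
    intro i hi
    obtain ⟨i', -, rfl⟩ := Finset.mem_image.1 hi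
    exact Finset.mem_range.2 (Nat.mod_lt _ (D.len_pos n))
  have h2 : ∑ i ∈ F, ‖x (D.b n + i)‖ / ‖D.partialProd n i‖ -
      ∑ i ∈ F, ‖y (D.b n + (t + i) % D.len n)‖ / ‖D.partialProd n ((t + i) % D.len n)‖ ≤
      ∑ i ∈ F, ‖((D.operator ^ t) x) (D.b n + (t + i) % D.len n)‖ /
        ‖D.partialProd n ((t + i) % D.len n)‖ := by
    rw [← Finset.sum_sub_distrib]
    refine Finset.sum_le_sum fun i hi => ?_
    have hp := norm_pos_iff.2 (D.partialProd_ne_zero n ((t + i) % D.len n))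
    have hc := D.norm_coord_operator_pow_proj n t x (Finset.mem_range.1 (hF hi))
    have hx : (D.operator ^ t) (D.proj n x) = (D.operator ^ t) x - y := by
      rw [hy, map_sub, sub_sub_cancel]
    rw [hx, sub_apply'] at hc
    rw [← mul_le_mul_iff_left₀ hp, sub_mul, ← hc, div_mul_cancel₀ _ hp.ne',
      div_mul_cancel₀ _ hp.ne', sub_le_iff_le_add]
    exact norm_sub_le _ _
  linarith

end Data
end CType

/-! ### Counting the times at which the orbit is small -/

namespace CType

/-- A time is determined by the remainder and the quotient of `t + i` by `L`, and the quotient is at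
most `J / L + 1`. -/
lemma card_filter_add_mod_mem_le {L : ℕ} (J i : ℕ) (hi : i < L) (B : Finset ℕ) :
    ((Finset.range J).filter fun t => (t + i) % L ∈ B).card ≤ B.card * (J / L + 2) := by
  have hL : 0 < L := by omega
  rw [← Finset.card_range (J / L + 2), ← Finset.card_product]
  refine Finset.card_le_card_of_injOn (fun t => ((t + i) % L, (t + i) / L)) ?_ ?_
  · intro t ht
    have ht' := Finset.mem_filter.1 (Finset.mem_coe.1 ht)
    have h1 : t < J := Finset.mem_range.1 ht'.1
    refine Finset.mem_coe.2 (Finset.mem_product.2 ⟨ht'.2, Finset.mem_range.2 ?_⟩)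
    have : (t + i) / L ≤ (J + L) / L := Nat.div_le_div_right (by omega)
    rw [Nat.add_div_right _ hL] at this
    show (t + i) / L < J / L + 2
    omega
  · intro t _ t' _ h
    have h1 : (t + i) % L = (t' + i) % L := congrArg Prod.fst h
    have h2 : (t + i) / L = (t' + i) / L := congrArg Prod.snd h
    have h3 := Nat.mod_add_div (t + i) L
    have h4 := Nat.mod_add_div (t' + i) L
    rw [h1, h2] at h3
    omega

namespace Data

variable {D : Data} {d lo hi : ℕ → ℕ}

/-- The positions of the `n`-th block at which the partial product may be smaller than its
maximal modulus. -/
def lowSet (D : Data) (lo hi : ℕ → ℕ) (n : ℕ) : Finset ℕ :=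
  Finset.range (lo n) ∪ Finset.Ico (D.len n - hi n) (D.len n)

lemma card_lowSet_le (n : ℕ) : (D.lowSet lo hi n).card ≤ lo n + hi n := by
  refine (Finset.card_union_le _ _).trans ?_
  rw [Finset.card_range, Nat.card_Ico]
  omega

lemma Profile.norm_partialProd_of_notMem (hP : D.Profile d lo hi) {n : ℕ} (hn : 1 ≤ n) {i : ℕ}
    (hi' : i < D.len n) (h : i ∉ D.lowSet lo hi n) : ‖D.partialProd n i‖ = D.height n := by
  rw [lowSet, Finset.mem_union, Finset.mem_range, Finset.mem_Ico] at h
  exact hP.top n hn i (by omega) (by omega)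

/-- At least three quarters of the mass are carried to places of full height and the other blocks
cancel at most one half, so a quarter survives there. -/
lemma Profile.le_norm_operator_pow (hP : D.Profile d lo hi) {n : ℕ} (hn : 1 ≤ n) {t : ℕ}
    {x : EllOne} (ht : D.height n * D.mass n ((D.operator ^ t) (x - D.proj n x)) ≤
      D.height n * D.mass n x / 2)
    (hlow : ∑ i ∈ (Finset.range (D.len n)).filter fun i => (t + i) % D.len n ∈ D.lowSet lo hi n,
      ‖x (D.b n + i)‖ / ‖D.partialProd n i‖ ≤ D.mass n x / 4) :
    D.height n * D.mass n x / 4 ≤ ‖(D.operator ^ t) x‖ := by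
  set F := (Finset.range (D.len n)).filter fun i => (t + i) % D.len n ∉ D.lowSet lo hi n with hF
  have hsplit := Finset.sum_filter_add_sum_filter_not (Finset.range (D.len n))
    (fun i => (t + i) % D.len n ∈ D.lowSet lo hi n)
    fun i => ‖x (D.b n + i)‖ / ‖D.partialProd n i‖
  rw [← hF] at hsplit
  change _ = D.mass n x at hsplit
  have h1 := D.sum_mass_sub_le n t x (Finset.filter_subset _ _ : F ⊆ _)
  have h2 : ∑ i ∈ F, ‖((D.operator ^ t) x) (D.b n + (t + i) % D.len n)‖ /
      ‖D.partialProd n ((t + i) % D.len n)‖ ≤ ‖(D.operator ^ t) x‖ / D.height n := by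
    have h3 : ∑ i ∈ F, ‖((D.operator ^ t) x) (D.b n + (t + i) % D.len n)‖ /
        ‖D.partialProd n ((t + i) % D.len n)‖ =
        (∑ i ∈ F, ‖((D.operator ^ t) x) (D.b n + (t + i) % D.len n)‖) / D.height n := by
      rw [Finset.sum_div]
      refine Finset.sum_congr rfl fun i hi => ?_
      rw [hP.norm_partialProd_of_notMem hn (Nat.mod_lt _ (D.len_pos n)) (Finset.mem_filter.1 hi).2]
    rw [h3]
    refine div_le_div_of_nonneg_right ?_ (D.height_pos n).le
    rw [← Finset.sum_image (g := fun i => D.b n + (t + i) % D.len n)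
      (f := fun k => ‖((D.operator ^ t) x) k‖)]
    · exact sum_norm_coord_le _ _
    · intro i hi i' hi' h
      exact add_mod_injOn t n (Finset.mem_coe.2 (Finset.mem_filter.1 hi).1)
        (Finset.mem_coe.2 (Finset.mem_filter.1 hi').1) (Nat.add_left_cancel h)
  have hh := D.height_pos n
  rw [le_div_iff₀ hh] at h2
  nlinarith

/-- Markov's inequality: exchanging the sums over times and places, each place spends at most `(lo n
+ hi n) * (J / len n + 2)` times in the low set. -/
lemma card_low_mul_mass_le (n J : ℕ) (x : EllOne) :
    (((Finset.range J).filter fun t => D.mass n x / 4 <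
      ∑ i ∈ (Finset.range (D.len n)).filter fun i => (t + i) % D.len n ∈ D.lowSet lo hi n,
        ‖x (D.b n + i)‖ / ‖D.partialProd n i‖).card : ℝ) * (D.mass n x / 4) ≤
      D.mass n x * ((lo n + hi n : ℕ) * (J / D.len n + 2 : ℕ)) := by
  set g : ℕ → ℝ := fun t =>
    ∑ i ∈ (Finset.range (D.len n)).filter fun i => (t + i) % D.len n ∈ D.lowSet lo hi n,
      ‖x (D.b n + i)‖ / ‖D.partialProd n i‖ with hg
  have hg0 : ∀ t, 0 ≤ g t := fun t => Finset.sum_nonneg fun _ _ => by positivity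
  calc _ = ∑ t ∈ (Finset.range J).filter fun t => D.mass n x / 4 < g t, D.mass n x / 4 := by
        rw [Finset.sum_const, nsmul_eq_mul]
    _ ≤ ∑ t ∈ (Finset.range J).filter fun t => D.mass n x / 4 < g t, g t :=
        Finset.sum_le_sum fun t ht => (Finset.mem_filter.1 ht).2.le
    _ ≤ ∑ t ∈ Finset.range J, g t :=
        Finset.sum_le_sum_of_subset_of_nonneg (Finset.filter_subset _ _) fun _ _ _ => hg0 _
    _ = ∑ i ∈ Finset.range (D.len n), ‖x (D.b n + i)‖ / ‖D.partialProd n i‖ *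
          ((Finset.range J).filter fun t => (t + i) % D.len n ∈ D.lowSet lo hi n).card := by
        simp only [hg, Finset.sum_filter]
        rw [Finset.sum_comm]
        refine Finset.sum_congr rfl fun i _ => ?_
        rw [← Finset.sum_filter, Finset.sum_const, nsmul_eq_mul, mul_comm]
    _ ≤ ∑ i ∈ Finset.range (D.len n), ‖x (D.b n + i)‖ / ‖D.partialProd n i‖ *
          ((lo n + hi n : ℕ) * (J / D.len n + 2 : ℕ)) := by
        refine Finset.sum_le_sum fun i hi' => mul_le_mul_of_nonneg_left ?_ (by positivity)
        have h := (card_filter_add_mod_mem_le J i (Finset.mem_range.1 hi')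
          (D.lowSet lo hi n)).trans (Nat.mul_le_mul_right _ (card_lowSet_le n))
        exact_mod_cast h
    _ = _ := by rw [← Finset.sum_mul, mass]

/-- The mass of the block itself is preserved, and its partial products are bounded below, so the
orbit can be very small only if the other blocks cancel it. -/
lemma exists_half_mass_lt {n : ℕ} {x : EllOne} (hx : 0 < D.mass n x)
    (hsmall : ∀ η : ℝ, 0 < η → ∃ t, ‖(D.operator ^ t) x‖ < η) :
    ∃ t, D.height n * D.mass n x / 2 <
      D.height n * D.mass n ((D.operator ^ t) (x - D.proj n x)) := by
  obtain ⟨C, hC0, hC⟩ : ∃ C : ℝ, 0 < C ∧ ∀ i, i < D.len n → C ≤ ‖D.partialProd n i‖ := by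
    have hne : (Finset.range (D.len n)).Nonempty := ⟨0, Finset.mem_range.2 (D.len_pos n)⟩
    obtain ⟨i, -, h⟩ := Finset.exists_min_image _ (fun i => ‖D.partialProd n i‖) hne
    exact ⟨_, norm_pos_iff.2 (D.partialProd_ne_zero n i), fun i' hi' => h i' (by simpa using hi')⟩
  have hl : (0 : ℝ) < D.len n := by exact_mod_cast D.len_pos n
  obtain ⟨t, ht⟩ := hsmall (D.mass n x / 2 / D.len n * C) (by positivity)
  refine ⟨t, ?_⟩
  have h1 := D.sum_mass_sub_le n t x (Finset.Subset.refl _)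
  have h2 : ∑ i ∈ Finset.range (D.len n), ‖((D.operator ^ t) x) (D.b n + (t + i) % D.len n)‖ /
      ‖D.partialProd n ((t + i) % D.len n)‖ ≤
      ∑ i ∈ Finset.range (D.len n), ‖(D.operator ^ t) x‖ / C :=
    Finset.sum_le_sum fun i _ => div_le_div₀ (norm_nonneg _) (norm_coord_le _ _) hC0
      (hC _ (Nat.mod_lt _ (D.len_pos n)))
  rw [Finset.sum_const, Finset.card_range, nsmul_eq_mul] at h2
  have h3 : (D.len n : ℝ) * (‖(D.operator ^ t) x‖ / C) < D.mass n x / 2 := by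
    rwa [← lt_div_iff₀' hl, div_lt_iff₀ hC0]
  change D.mass n x - _ ≤ _ at h1
  have h4 : D.mass n x / 2 < D.mass n ((D.operator ^ t) (x - D.proj n x)) := by linarith
  rw [mul_div_assoc]
  exact mul_lt_mul_of_pos_left h4 (D.height_pos n)

/-- As long as the `n`-th block of `x` is not disturbed, the orbit of `x` is rarely small; and the
block that disturbs it is at least as large. -/
lemma Profile.exists_time (hP : D.Profile d lo hi) {n : ℕ} (hn : 1 ≤ n) {x : EllOne}
    (hx : ‖x‖ ≤ 2 * (D.height n * D.mass n x)) (hpos : 0 < D.height n * D.mass n x)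
    (hsmall : ∀ η : ℝ, 0 < η → ∃ t, ‖(D.operator ^ t) x‖ < η) :
    ∃ J m, n ≤ D.φ m ∧ d m < J ∧ D.height n * D.mass n x ≤ D.height m * D.mass m x ∧
      ((Finset.range J).filter fun t =>
        ‖(D.operator ^ t) x‖ < D.height n * D.mass n x / 4).card ≤
        4 * ((lo n + hi n) * (J / D.len n + 2)) := by
  classical
  have hmass : 0 < D.mass n x := (mul_pos_iff_of_pos_left (D.height_pos n)).1 hpos
  have hex := exists_half_mass_lt hmass hsmall
  obtain ⟨m, h1, h2, h3⟩ := hP.exists_height_mul_mass_ge hn hx hpos (Nat.find_spec hex)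
  -- Taking the first disturbed time ensures that before it the orbit is small only when much of the
  -- mass lies in the low set.
  refine ⟨Nat.find hex, m, h1, h2, h3, ?_⟩
  set J := Nat.find hex
  have hcard := card_low_mul_mass_le (D := D) (lo := lo) (hi := hi) n J x
  have hsub : ((Finset.range J).filter fun t =>
      ‖(D.operator ^ t) x‖ < D.height n * D.mass n x / 4) ⊆
      (Finset.range J).filter fun t => D.mass n x / 4 <
      ∑ i ∈ (Finset.range (D.len n)).filter fun i => (t + i) % D.len n ∈ D.lowSet lo hi n,
        ‖x (D.b n + i)‖ / ‖D.partialProd n i‖ := by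
    intro t ht
    obtain ⟨htJ, ht⟩ := Finset.mem_filter.1 ht
    refine Finset.mem_filter.2 ⟨htJ, ?_⟩
    by_contra hlow
    have := Nat.find_min hex (Finset.mem_range.1 htJ)
    exact absurd (hP.le_norm_operator_pow hn (not_lt.1 this) (not_lt.1 hlow)) (not_le.2 ht)
  have h4 := Finset.card_le_card hsub
  rw [mul_comm, div_mul_eq_mul_div, mul_div_assoc, mul_le_mul_iff_right₀ hmass,
    div_le_iff₀ (by norm_num)] at hcard
  have h5 : ((Finset.range J).filter fun t => D.mass n x / 4 <
      ∑ i ∈ (Finset.range (D.len n)).filter fun i => (t + i) % D.len n ∈ D.lowSet lo hi n,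
        ‖x (D.b n + i)‖ / ‖D.partialProd n i‖).card ≤
      (lo n + hi n) * (J / D.len n + 2) * 4 := by exact_mod_cast hcard
  omega

/-- The orbit of `x` is rarely small up to some arbitrarily large times. -/
lemma Profile.exists_card_le (hP : D.Profile d lo hi)
    (hlim : ∀ ε : ℝ, 0 < ε → ∃ N, ∀ n, N ≤ n → ((lo n + hi n : ℕ) : ℝ) ≤ ε * D.len n)
    (hlim' : ∀ ε : ℝ, 0 < ε → ∃ N, ∀ n, N ≤ n → ∀ m, n ≤ D.φ m →
      ((lo n + hi n : ℕ) : ℝ) ≤ ε * d m)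
    (hlo : ∀ n, n ≤ lo n) {x : EllOne} {a : ℝ} (ha : 0 < a) (hxa : ‖x‖ ≤ 2 * a) {n₀ : ℕ}
    (hn₀ : 1 ≤ n₀) (hx : a ≤ D.height n₀ * D.mass n₀ x)
    (hsmall : ∀ η : ℝ, 0 < η → ∃ t, ‖(D.operator ^ t) x‖ < η) {ε : ℝ} (hε : 0 < ε) (N : ℕ) :
    ∃ J, N ≤ J ∧
      (((Finset.range J).filter fun t => ‖(D.operator ^ t) x‖ < a / 4).card : ℝ) ≤ ε * J := by
  -- Passing from `n` to the disturbing block `m` increases the index, as `n ≤ φ m < m`, and does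
  -- not decrease `height * mass`.
  have hchain : ∀ M : ℕ, ∃ n, M ≤ n ∧ 1 ≤ n ∧ a ≤ D.height n * D.mass n x := by
    intro M
    induction M with
    | zero => exact ⟨n₀, Nat.zero_le _, hn₀, hx⟩
    | succ M ih =>
      obtain ⟨n, hMn, hn, hxn⟩ := ih
      obtain ⟨J, m, h1, -, h3, -⟩ := hP.exists_time hn (by linarith) (by linarith) hsmall
      have hm : 1 ≤ m := by
        rcases Nat.eq_zero_or_pos m with rfl | hm
        · rw [D.φ_zero] at h1; omega
        · exact hm
      have := D.φ_lt m hm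
      exact ⟨m, by omega, hm, hxn.trans h3⟩
  obtain ⟨N₁, hN₁⟩ := hlim (ε / 8) (by positivity)
  obtain ⟨N₂, hN₂⟩ := hlim' (ε / 16) (by positivity)
  -- This makes `J` large: `J > d m ≥ lo n + hi n ≥ n ≥ N`.
  obtain ⟨N₃, hN₃⟩ := hlim' 1 one_pos
  obtain ⟨n, hMn, hn, hxn⟩ := hchain (N + N₁ + N₂ + N₃)
  obtain ⟨J, m, h1, h2, -, h4⟩ := hP.exists_time hn (by linarith) (by linarith) hsmall
  have e1 := hN₁ n (by omega)
  have e2 := hN₂ n (by omega) m h1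
  have e3 := hN₃ n (by omega) m h1
  rw [one_mul] at e3
  have e3' : lo n + hi n ≤ d m := by exact_mod_cast e3
  refine ⟨J, by have := hlo n; omega, ?_⟩
  have hsub : ((Finset.range J).filter fun t => ‖(D.operator ^ t) x‖ < a / 4) ⊆
      (Finset.range J).filter fun t => ‖(D.operator ^ t) x‖ < D.height n * D.mass n x / 4 :=
    Finset.monotone_filter_right _ fun t _ ht => ht.trans_le (by linarith)
  have h5 : ((((Finset.range J).filter fun t => ‖(D.operator ^ t) x‖ < a / 4).card : ℕ) : ℝ) ≤
      4 * ((lo n + hi n : ℕ) * ((J / D.len n : ℕ) + 2)) := by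
    exact_mod_cast (Finset.card_le_card hsub).trans h4
  refine h5.trans ?_
  have hl : (0 : ℝ) < D.len n := by exact_mod_cast D.len_pos n
  have h6 : ((J / D.len n : ℕ) : ℝ) * D.len n ≤ J := by exact_mod_cast Nat.div_mul_le_self _ _
  have h7 : (d m : ℝ) ≤ J := by exact_mod_cast h2.le
  have h8 : ((lo n + hi n : ℕ) : ℝ) * (J / D.len n : ℕ) ≤ ε / 8 * J := by
    calc _ ≤ ε / 8 * D.len n * (J / D.len n : ℕ) := mul_le_mul_of_nonneg_right e1 (by positivity)
      _ = ε / 8 * ((J / D.len n : ℕ) * D.len n) := by ring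
      _ ≤ _ := mul_le_mul_of_nonneg_left h6 (by positivity)
  have h9 : ((lo n + hi n : ℕ) : ℝ) ≤ ε / 16 * J :=
    e2.trans (mul_le_mul_of_nonneg_left h7 (by positivity))
  linarith

end Data
end CType

/-! ### Verification of the profile for the given parameters -/

namespace CType

/-- The three terms of the exponent count the factors `2` of the first run, those of the late run,
and the factors `1/2`; truncated subtraction keeps each count at zero until its run begins. -/
lemma prod_weight_eq {k n d L : ℕ} (hL : (k + 3) * d + 4 * n + 2 < L) {i : ℕ} (hi : i < L) :
    ∏ j ∈ Finset.range i, weight k n d L (j + 1) = (2 : ℂ) ^ ((min i (k * d + 2 * n + 1) : ℕ) +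
      (min (i - (L - 2 * d - 1)) d : ℕ) - (min (i - (L - 3 * d - 2 * n - 2)) (d + 2 * n + 1) : ℕ) :
      ℤ) := by
  have hL' : k * d + 3 * d + 4 * n + 2 < L := by rw [add_mul] at hL; exact hL
  clear hL
  generalize hc : k * d = c at hL' ⊢
  induction i with
  | zero => simp
  | succ i ih =>
    have h2 : (2 : ℂ) ≠ 0 := two_ne_zero
    rw [Finset.prod_range_succ, ih (by omega), weight, hc]
    split_ifs
    · rw [← zpow_add_one₀ h2]
      congr 1; omega
    · rw [mul_one]
      congr 1; omega
    · rw [one_div, ← zpow_sub_one₀ h2]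
      congr 1; omega
    · rw [← zpow_add_one₀ h2]
      congr 1; omega
    · rw [mul_one]
      congr 1; omega

/-- The index `k` such that `n_k ≤ n < n_{k+1}`. -/
def group (ψ₁ : ℕ → ℕ) (n : ℕ) : ℕ := Nat.findGreatest (fun k => nSeq ψ₁ k ≤ n) n

namespace Data.IsAssociated

variable {D : Data} {ψ₁ ψ₂ δ τ Δ : ℕ → ℕ}

lemma nSeq_strictMono (hD : D.IsAssociated ψ₁ ψ₂ δ τ Δ) : StrictMono (nSeq ψ₁) := by
  refine strictMono_nat_of_lt_succ fun k => ?_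
  match k with
  | 0 => simp [nSeq]
  | k + 1 =>
    have := hD.one_le_psi₁ (k + 1) (by omega)
    rw [nSeq]; omega

lemma nSeq_group_le (n : ℕ) : nSeq ψ₁ (group ψ₁ n) ≤ n :=
  Nat.findGreatest_spec (P := fun k => nSeq ψ₁ k ≤ n) (Nat.zero_le n) (Nat.zero_le n)

lemma lt_nSeq_group (hD : D.IsAssociated ψ₁ ψ₂ δ τ Δ) (n : ℕ) :
    n < nSeq ψ₁ (group ψ₁ n + 1) := by
  by_contra! h
  have h1 := (hD.nSeq_strictMono.le_apply).trans h
  have := Nat.le_findGreatest (P := fun k => nSeq ψ₁ k ≤ n) h1 h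
  unfold group at this
  omega

lemma le_group (hD : D.IsAssociated ψ₁ ψ₂ δ τ Δ) {k n : ℕ} (h : nSeq ψ₁ k ≤ n) :
    k ≤ group ψ₁ n :=
  Nat.le_findGreatest ((hD.nSeq_strictMono.le_apply).trans h) h

lemma group_le (n : ℕ) : group ψ₁ n ≤ n := Nat.findGreatest_le n

lemma one_le_group (hD : D.IsAssociated ψ₁ ψ₂ δ τ Δ) {n : ℕ} (hn : 1 ≤ n) : 1 ≤ group ψ₁ n :=
  hD.le_group (by simpa [nSeq] using hn)

lemma one_le_psi₂ (hD : D.IsAssociated ψ₁ ψ₂ δ τ Δ) {k : ℕ} (hk : 1 ≤ k) : 1 ≤ ψ₂ k := by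
  have := hD.psi₁_lt_min k hk
  omega

lemma len_eq (hD : D.IsAssociated ψ₁ ψ₂ δ τ Δ) {n : ℕ} (hn : 1 ≤ n) :
    D.len n = Δ (group ψ₁ n) :=
  hD.b_eq _ (hD.one_le_group hn) n ⟨nSeq_group_le n, hD.lt_nSeq_group n⟩

lemma lt_len (hD : D.IsAssociated ψ₁ ψ₂ δ τ Δ) {n : ℕ} (hn : 1 ≤ n) :
    (group ψ₁ n + 3) * δ (ψ₂ (group ψ₁ n)) + 4 * n + 2 < D.len n := by
  have h1 := hD.Delta_gt _ (hD.one_le_group hn)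
  have h2 := hD.lt_nSeq_group n
  rw [hD.len_eq hn]
  omega

lemma partialProd_eq (hD : D.IsAssociated ψ₁ ψ₂ δ τ Δ) {n i : ℕ} (hn : 1 ≤ n)
    (hi : i < D.len n) :
    D.partialProd n i = ∏ j ∈ Finset.range i,
      weight (group ψ₁ n) n (δ (ψ₂ (group ψ₁ n))) (D.len n) (j + 1) := by
  refine Finset.prod_congr rfl fun j hj => ?_
  have hj := Finset.mem_range.1 hj
  rw [hD.len_eq hn] at hi ⊢
  rw [← hD.w_eq _ (hD.one_le_group hn) n ⟨nSeq_group_le n, hD.lt_nSeq_group n⟩ (j + 1)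
    ⟨by omega, by omega⟩]
  congr 1; omega

lemma norm_partialProd_eq (hD : D.IsAssociated ψ₁ ψ₂ δ τ Δ) {n i : ℕ} (hn : 1 ≤ n)
    (hi : i < D.len n) {a : ℕ}
    (ha : (min i (group ψ₁ n * δ (ψ₂ (group ψ₁ n)) + 2 * n + 1) : ℕ) +
      (min (i - (D.len n - 2 * δ (ψ₂ (group ψ₁ n)) - 1)) (δ (ψ₂ (group ψ₁ n))) : ℕ) -
      (min (i - (D.len n - 3 * δ (ψ₂ (group ψ₁ n)) - 2 * n - 2))
        (δ (ψ₂ (group ψ₁ n)) + 2 * n + 1) : ℕ) = (a : ℤ)) :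
    ‖D.partialProd n i‖ = 2 ^ a := by
  rw [hD.partialProd_eq hn hi, prod_weight_eq (hD.lt_len hn) hi, ha]
  simp

lemma norm_blockProd_eq (hD : D.IsAssociated ψ₁ ψ₂ δ τ Δ) {n : ℕ} (hn : 1 ≤ n) :
    ‖D.blockProd n‖ = 2 ^ (group ψ₁ n * δ (ψ₂ (group ψ₁ n))) := by
  have h := hD.lt_len hn
  rw [add_mul] at h
  rw [D.blockProd_eq_partialProd]
  refine hD.norm_partialProd_eq hn (by omega) ?_
  generalize group ψ₁ n * δ (ψ₂ (group ψ₁ n)) = c at h ⊢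
  omega

lemma height_eq (hD : D.IsAssociated ψ₁ ψ₂ δ τ Δ) {n : ℕ} (hn : 1 ≤ n) :
    D.height n = 2 ^ (group ψ₁ n * δ (ψ₂ (group ψ₁ n)) + 2 * n + 1) := by
  rw [height, hD.norm_blockProd_eq hn, ← pow_add]
  congr 1; omega

lemma phi_lt (hD : D.IsAssociated ψ₁ ψ₂ δ τ Δ) {m : ℕ} (hm : 1 ≤ m) :
    D.φ m < ψ₁ (group ψ₁ m) := by
  have h1 := nSeq_group_le (ψ₁ := ψ₁) m
  have h2 := hD.lt_nSeq_group m
  rw [hD.phi_eq _ (hD.one_le_group hm) m ⟨h1, h2⟩]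
  obtain ⟨k, hk⟩ : ∃ k, group ψ₁ m = k + 1 := ⟨group ψ₁ m - 1, by
    have := hD.one_le_group hm; omega⟩
  rw [hk] at h1 h2 ⊢
  rw [nSeq] at h2
  omega

/-- The parameters of a block and of the blocks below its image under `φ`. -/
lemma group_bounds (hD : D.IsAssociated ψ₁ ψ₂ δ τ Δ) {n m : ℕ} (hn : 1 ≤ n) (hm : 1 ≤ m)
    (h : n ≤ D.φ m) : n < ψ₂ (group ψ₁ m) ∧ group ψ₁ n < ψ₂ (group ψ₁ m) ∧
      δ (ψ₂ (group ψ₁ n)) ≤ δ (ψ₂ (group ψ₁ m) - 1) := by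
  have h1 := hD.phi_lt hm
  have h2 := hD.psi₁_lt_min _ (hD.one_le_group hm)
  have h3 := group_le (ψ₁ := ψ₁) n
  -- The condition on `ψ₂` applies to the group of `n` because `group n ≤ n ≤ φ m < ψ₁ (group m)`.
  have h4 := hD.psi₂_gt _ (hD.one_le_group hm) _ (hD.one_le_group hn) (by omega)
  have h5 := hD.one_le_psi₂ (hD.one_le_group hn)
  exact ⟨by omega, by omega, hD.delta_mono h5 (Set.mem_Ici.2 (by omega)) (by omega)⟩

lemma profile (hD : D.IsAssociated ψ₁ ψ₂ δ τ Δ)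
    (hγ : ∀ k : ℕ, 1 ≤ k → gammaSeq ψ₁ δ τ k ≤ (2 : ℝ) ^ (-16 * (k : ℤ))) :
    D.Profile (fun n => δ (ψ₂ (group ψ₁ n)))
      (fun n => group ψ₁ n * δ (ψ₂ (group ψ₁ n)) + 2 * n + 1)
      (fun n => 3 * δ (ψ₂ (group ψ₁ n)) + 2 * n + 1) where
  top n hn i h1 h2 := by
    have h := hD.lt_len hn
    rw [add_mul] at h
    rw [hD.height_eq hn]
    refine hD.norm_partialProd_eq hn (by omega) ?_
    generalize group ψ₁ n * δ (ψ₂ (group ψ₁ n)) = c at h h1 ⊢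
    omega
  tail n hn i h1 h2 := by
    have h := hD.lt_len hn
    rw [add_mul] at h
    rw [hD.norm_blockProd_eq hn]
    refine hD.norm_partialProd_eq hn h1 ?_
    generalize group ψ₁ n * δ (ψ₂ (group ψ₁ n)) = c at h ⊢
    omega
  lo_add_hi_lt n hn := by
    have h := hD.lt_len hn
    rw [add_mul] at h
    omega
  leak_le m hm hφ := by
    have hk := hD.one_le_group hm
    obtain ⟨h1, h2, h3⟩ := hD.group_bounds hφ hm le_rfl
    rw [hD.height_eq hφ, hD.v_eq _ hk m ⟨nSeq_group_le m, hD.lt_nSeq_group m⟩]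
    set μ := ψ₂ (group ψ₁ m) with hμ
    set s := group ψ₁ (D.φ m)
    have hγμ := hγ μ (by omega)
    -- Together with `φ m < μ ≤ n_μ`, this bounds the exponent of `‖v m‖ * height (φ m)` by that of
    -- `γ_μ`.
    have h4 : s * δ (ψ₂ s) ≤ μ * δ (μ - 1) := Nat.mul_le_mul h2.le h3
    have h5 : μ ≤ nSeq ψ₁ μ := hD.nSeq_strictMono.le_apply
    calc _ = (2 : ℝ) ^ (-(τ μ : ℤ) + (s * δ (ψ₂ s) + 2 * D.φ m + 1 : ℕ)) := by
          rw [zpow_add₀ two_ne_zero, zpow_natCast, norm_zpow]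
          simp
      _ ≤ gammaSeq ψ₁ δ τ μ := by
          refine zpow_le_zpow_right₀ one_le_two ?_
          zify at h4
          push_cast
          omega
      _ ≤ (2 : ℝ) ^ (-16 * (μ : ℤ)) := hγμ
      _ ≤ (2 : ℝ) ^ (-16 : ℤ) := zpow_le_zpow_right₀ one_le_two (by omega)
      _ = _ := by norm_num

lemma exists_low_le_len (hD : D.IsAssociated ψ₁ ψ₂ δ τ Δ)
    (hΔ : Tendsto
      (fun k : ℕ => ((k : ℝ) * (δ (ψ₂ k) : ℝ) + (nSeq ψ₁ (k + 1) : ℝ)) / (Δ k : ℝ)) atTop (𝓝 0))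
    {ε : ℝ} (hε : 0 < ε) : ∃ N, ∀ n, N ≤ n →
      ((group ψ₁ n * δ (ψ₂ (group ψ₁ n)) + 2 * n + 1 +
        (3 * δ (ψ₂ (group ψ₁ n)) + 2 * n + 1) : ℕ) : ℝ) ≤ ε * D.len n := by
  obtain ⟨K, hK⟩ := eventually_atTop.1 (hΔ.eventually (gt_mem_nhds (show 0 < ε / 4 by positivity)))
  refine ⟨nSeq ψ₁ K + 1, fun n hn => ?_⟩
  have hn1 : 1 ≤ n := by omega
  have h1 := hK _ (hD.le_group (show nSeq ψ₁ K ≤ n by omega))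
  have hl : (0 : ℝ) < Δ (group ψ₁ n) := by
    rw [← hD.len_eq hn1]; exact_mod_cast D.len_pos n
  rw [div_lt_iff₀ hl] at h1
  rw [hD.len_eq hn1]
  have h2 := hD.lt_nSeq_group n
  have h3 := hD.one_le_group hn1
  set g := group ψ₁ n
  have h4 : g * δ (ψ₂ g) + 2 * n + 1 + (3 * δ (ψ₂ g) + 2 * n + 1) ≤
      4 * (g * δ (ψ₂ g) + nSeq ψ₁ (g + 1)) := by
    have : 1 * δ (ψ₂ g) ≤ g * δ (ψ₂ g) := Nat.mul_le_mul_right _ h3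
    omega
  have h5 : ((g * δ (ψ₂ g) + 2 * n + 1 + (3 * δ (ψ₂ g) + 2 * n + 1) : ℕ) : ℝ) ≤
      4 * ((g : ℝ) * δ (ψ₂ g) + nSeq ψ₁ (g + 1)) := by exact_mod_cast h4
  linarith

lemma exists_low_le_delta (hD : D.IsAssociated ψ₁ ψ₂ δ τ Δ)
    (hδ : Tendsto (fun k : ℕ => ((k : ℝ) * (δ k : ℝ)) / (δ (k + 1) : ℝ)) atTop (𝓝 0))
    {ε : ℝ} (hε : 0 < ε) : ∃ N, ∀ n, N ≤ n → ∀ m, n ≤ D.φ m →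
      ((group ψ₁ n * δ (ψ₂ (group ψ₁ n)) + 2 * n + 1 +
        (3 * δ (ψ₂ (group ψ₁ n)) + 2 * n + 1) : ℕ) : ℝ) ≤ ε * δ (ψ₂ (group ψ₁ m)) := by
  obtain ⟨K, hK⟩ := eventually_atTop.1
    (hδ.eventually (gt_mem_nhds (show 0 < ε / 10 by positivity)))
  refine ⟨K + 1, fun n hn m hm => ?_⟩
  have hn1 : 1 ≤ n := by omega
  have hm1 : 1 ≤ m := by
    rcases Nat.eq_zero_or_pos m with rfl | h
    · rw [D.φ_zero] at hm; omega
    · exact h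
  obtain ⟨h1, h2, h3⟩ := hD.group_bounds hn1 hm1 hm
  obtain ⟨μ, hμ⟩ : ∃ μ, ψ₂ (group ψ₁ m) = μ + 1 := ⟨ψ₂ (group ψ₁ m) - 1, by omega⟩
  rw [hμ] at h1 h2 h3 ⊢
  rw [Nat.add_sub_cancel] at h3
  have h4 := hK μ (by omega)
  have h5 : (0 : ℝ) < δ (μ + 1) := by exact_mod_cast hD.delta_pos (μ + 1) (by omega)
  rw [div_lt_iff₀ h5] at h4
  set g := group ψ₁ n
  have hμδ : 0 < δ μ := hD.delta_pos μ (by omega)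
  -- As `n ≤ μ`, `g ≤ μ` and `1 ≤ μ`, the terms contribute at most `1 + 3 + 6` copies of `μ * δ μ`.
  have h6 : g * δ (ψ₂ g) + 2 * n + 1 + (3 * δ (ψ₂ g) + 2 * n + 1) ≤ 10 * (μ * δ μ) := by
    have e1 : g * δ (ψ₂ g) ≤ μ * δ μ := Nat.mul_le_mul (by omega) h3
    have e2 : 1 * δ μ ≤ μ * δ μ := Nat.mul_le_mul_right _ (by omega)
    have e3 : μ * 1 ≤ μ * δ μ := Nat.mul_le_mul_left _ hμδ
    omega
  have h7 : ((g * δ (ψ₂ g) + 2 * n + 1 + (3 * δ (ψ₂ g) + 2 * n + 1) : ℕ) : ℝ) ≤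
      10 * ((μ : ℝ) * δ μ) := by exact_mod_cast h6
  linarith

end Data.IsAssociated
end CType

/-! ### Upper and lower densities -/

namespace CType

lemma density_ratio_nonneg (A : Set ℕ) (N : ℕ) :
    0 ≤ ((A ∩ Set.Iic N).ncard : ℝ) / ((N : ℝ) + 1) := by positivity

lemma ncard_Iic (N : ℕ) : (Set.Iic N).ncard = N + 1 := by
  rw [← Finset.coe_Iic, Set.ncard_coe_finset, Nat.card_Iic]

lemma density_ratio_add_compl (A : Set ℕ) (N : ℕ) :
    ((A ∩ Set.Iic N).ncard : ℝ) / ((N : ℝ) + 1) + ((Aᶜ ∩ Set.Iic N).ncard : ℝ) / ((N : ℝ) + 1) =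
      1 := by
  have h := Set.ncard_inter_add_ncard_sdiff_eq_ncard (Set.Iic N) A (Set.finite_Iic N)
  rw [ncard_Iic, Set.inter_comm, Set.sdiff_eq, Set.inter_comm (Set.Iic N)] at h
  rw [← add_div, div_eq_one_iff_eq (by positivity)]
  exact_mod_cast h

lemma density_ratio_le_one (A : Set ℕ) (N : ℕ) :
    ((A ∩ Set.Iic N).ncard : ℝ) / ((N : ℝ) + 1) ≤ 1 := by
  have := density_ratio_add_compl A N
  have := density_ratio_nonneg Aᶜ N
  linarith

lemma isBoundedUnder_le_density_ratio (A : Set ℕ) :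
    IsBoundedUnder (· ≤ ·) atTop fun N : ℕ => ((A ∩ Set.Iic N).ncard : ℝ) / ((N : ℝ) + 1) :=
  isBoundedUnder_of ⟨1, density_ratio_le_one A⟩

lemma isBoundedUnder_ge_density_ratio (A : Set ℕ) :
    IsBoundedUnder (· ≥ ·) atTop fun N : ℕ => ((A ∩ Set.Iic N).ncard : ℝ) / ((N : ℝ) + 1) :=
  isBoundedUnder_of ⟨0, density_ratio_nonneg A⟩

lemma upperDensity_eq_one {A : Set ℕ} (h : ∀ ε : ℝ, 0 < ε → ∀ N : ℕ, ∃ M, N ≤ M ∧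
    ((Aᶜ ∩ Set.Iic M).ncard : ℝ) ≤ ε * ((M : ℝ) + 1)) : upperDensity A = 1 := by
  refine le_antisymm ?_ (le_of_forall_pos_le_add fun ε hε => ?_)
  · exact limsup_le_of_le (isBoundedUnder_ge_density_ratio A).isCoboundedUnder_le
      (Eventually.of_forall (density_ratio_le_one A))
  · rw [← sub_le_iff_le_add]
    refine le_limsup_of_frequently_le ?_ (isBoundedUnder_le_density_ratio A)
    refine frequently_atTop.2 fun N => ?_
    obtain ⟨M, hNM, hM⟩ := h ε hε N
    refine ⟨M, hNM, ?_⟩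
    rw [← div_le_iff₀ (by positivity)] at hM
    have := density_ratio_add_compl A M
    linarith

lemma lowerDensity_le_of_upperDensity_compl_eq_one {A : Set ℕ} (h : upperDensity Aᶜ = 1) :
    lowerDensity A ≤ 0 := by
  by_contra! hpos
  obtain ⟨c, hc, hcA⟩ := exists_between hpos
  have hev := eventually_lt_of_lt_liminf hcA (isBoundedUnder_ge_density_ratio A)
  have hle : upperDensity Aᶜ ≤ 1 - c := by
    refine limsup_le_of_le (isBoundedUnder_ge_density_ratio Aᶜ).isCoboundedUnder_le ?_
    filter_upwards [hev] with N hN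
    have := density_ratio_add_compl A N
    linarith
  linarith

lemma returnTimes_compl {X : Type*} (T : X → X) (x : X) (U : Set X) :
    returnTimes T x Uᶜ = (returnTimes T x U)ᶜ := rfl

lemma IsFrequentlyHypercyclicVector.isHypercyclicVector {X : Type*} [TopologicalSpace X]
    {T : X → X} {x : X} (hx : IsFrequentlyHypercyclicVector T x) : IsHypercyclicVector T x := by
  refine dense_iff_inter_open.2 fun U hU hne => ?_
  have hpos := hx U hU hne
  have : (returnTimes T x U).Nonempty := by
    by_contra hempty
    rw [Set.not_nonempty_iff_eq_empty.1 hempty] at hpos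
    simp [lowerDensity] at hpos
  obtain ⟨n, hn⟩ := this
  exact ⟨_, hn, n, rfl⟩

end CType

/-! ### Hypercyclic vectors and the conclusion -/

namespace CType

/-- The space has no isolated points, so a dense orbit stays dense without its first `s` points. -/
lemma exists_add_mem_of_isHypercyclicVector {T : EllOne →L[ℂ] EllOne} {x : EllOne}
    (hx : IsHypercyclicVector T x) (s : ℕ) {U : Set EllOne} (hU : IsOpen U) (hne : U.Nonempty) :
    ∃ t, (T ^ (t + s)) x ∈ U := by
  have hfin : ((fun n : ℕ => T^[n] x) '' Set.Iio s).Finite := (Set.finite_Iio s).image _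
  have : Nontrivial EllOne := ⟨e 0, 0, norm_ne_zero_iff.1 (by rw [norm_e]; exact one_ne_zero)⟩
  have : ∀ y : EllOne, (𝓝[≠] y).NeBot := Module.punctured_nhds_neBot ℂ EllOne
  obtain ⟨y, hyU, ⟨n, rfl⟩, hn⟩ := (hx.sdiff_finite hfin).inter_open_nonempty U hU hne
  have hns : s ≤ n := not_lt.1 fun h => hn ⟨n, h, rfl⟩
  refine ⟨n - s, ?_⟩
  rw [Nat.sub_add_cancel hns, FunLike.coe_pow_eq_iterate]
  exact hyU

namespace Data

variable {D : Data} {d lo hi : ℕ → ℕ}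

lemma Profile.exists_upperDensity_eq_one (hP : D.Profile d lo hi)
    (hlim : ∀ ε : ℝ, 0 < ε → ∃ N, ∀ n, N ≤ n → ((lo n + hi n : ℕ) : ℝ) ≤ ε * D.len n)
    (hlim' : ∀ ε : ℝ, 0 < ε → ∃ N, ∀ n, N ≤ n → ∀ m, n ≤ D.φ m →
      ((lo n + hi n : ℕ) : ℝ) ≤ ε * d m)
    (hlo : ∀ n, n ≤ lo n) {x : EllOne} (hx : IsHypercyclicVector D.operator x) :
    ∃ r : ℝ, 0 < r ∧
      upperDensity (returnTimes D.operator x (Metric.ball (0 : EllOne) r)ᶜ) = 1 := by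
  have hlt := hP.lo_add_hi_lt 1 le_rfl
  -- At the place `lo 1` the partial product equals `height 1`, so a vector close to this basis
  -- vector has `height 1 * mass 1` at least `3/4` and norm at most `5/4`. This starts the chain of
  -- blocks.
  obtain ⟨s, hs⟩ := exists_add_mem_of_isHypercyclicVector hx 0
    (Metric.isOpen_ball (x := e (D.b 1 + lo 1)) (ε := 1 / 4)) (Metric.nonempty_ball.2 (by norm_num))
  rw [add_zero, mem_ball_iff_norm] at hs
  set y := (D.operator ^ s) x with hy
  have hy1 : ‖y‖ ≤ 2 * (3 / 4) := by
    have := norm_le_norm_add_norm_sub' y (e (D.b 1 + lo 1))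
    rw [norm_e] at this
    linarith
  have hy2 : 3 / 4 ≤ D.height 1 * D.mass 1 y := by
    have h1 : 3 / 4 ≤ ‖y (D.b 1 + lo 1)‖ := by
      have h2 := (norm_coord_le (y - e (D.b 1 + lo 1)) (D.b 1 + lo 1)).trans hs.le
      rw [sub_apply', e_apply, if_pos rfl] at h2
      have h3 := norm_sub_norm_le (1 : ℂ) (1 - y (D.b 1 + lo 1))
      rw [sub_sub_cancel, norm_sub_rev, norm_one] at h3
      linarith
    have h4 : ‖y (D.b 1 + lo 1)‖ / ‖D.partialProd 1 (lo 1)‖ ≤ D.mass 1 y :=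
      Finset.single_le_sum (f := fun i => ‖y (D.b 1 + i)‖ / ‖D.partialProd 1 i‖)
        (fun _ _ => by positivity) (Finset.mem_range.2 (by omega))
    rw [hP.top 1 le_rfl _ le_rfl hlt, div_le_iff₀' (D.height_pos 1)] at h4
    exact h1.trans h4
  have hpow : ∀ t, (D.operator ^ t) y = (D.operator ^ (t + s)) x := fun t => by
    rw [hy, pow_add, mul_apply_eq_comp]
  have hsmall : ∀ η : ℝ, 0 < η → ∃ t, ‖(D.operator ^ t) y‖ < η := fun η hη => by
    obtain ⟨t, ht⟩ := exists_add_mem_of_isHypercyclicVector hx s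
      (Metric.isOpen_ball (x := (0 : EllOne)) (ε := η)) (Metric.nonempty_ball.2 hη)
    rw [mem_ball_zero_iff] at ht
    exact ⟨t, by rwa [hpow]⟩
  refine ⟨3 / 4 / 4, by norm_num, upperDensity_eq_one fun ε hε N => ?_⟩
  -- `N'` is chosen so that the first `s` times and the endpoint `J` together cost at most `(ε / 2)
  -- * J`.
  obtain ⟨N', hN'⟩ := exists_nat_gt ((s + 1 : ℝ) / (ε / 2))
  obtain ⟨J, hJ, hcard⟩ := hP.exists_card_le hlim hlim' hlo (show (0 : ℝ) < 3 / 4 by norm_num) hy1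
    le_rfl hy2 hsmall (half_pos hε) (N + N')
  refine ⟨J, by omega, ?_⟩
  have hsub : (returnTimes D.operator x (Metric.ball (0 : EllOne) (3 / 4 / 4))ᶜ)ᶜ ∩ Set.Iic J ⊆
      (Finset.range s ∪ ((Finset.range (J + 1)).filter fun t =>
        ‖(D.operator ^ t) y‖ < 3 / 4 / 4).image (· + s) : Finset ℕ) := by
    rintro n ⟨hn, hnJ⟩
    rw [Finset.mem_coe, Finset.mem_union, Finset.mem_range, Finset.mem_image]
    by_cases hns : n < s
    · exact Or.inl hns
    · refine Or.inr ⟨n - s, Finset.mem_filter.2 ⟨Finset.mem_range.2 ?_, ?_⟩, by omega⟩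
      · have : n ≤ J := hnJ
        omega
      · rw [hpow, Nat.sub_add_cancel (by omega), FunLike.coe_pow_eq_iterate]
        have : D.operator^[n] x ∈ Metric.ball (0 : EllOne) (3 / 4 / 4) := by
          by_contra h
          exact hn h
        exact mem_ball_zero_iff.1 this
  have h1 := (Set.ncard_le_ncard hsub (Finset.finite_toSet _)).trans
    ((Set.ncard_coe_finset _).le.trans (Finset.card_union_le _ _))
  have h2 := Finset.card_image_le (f := (· + s)) (s := (Finset.range (J + 1)).filter fun t =>
        ‖(D.operator ^ t) y‖ < 3 / 4 / 4)
  have h3 : ((Finset.range (J + 1)).filter fun t => ‖(D.operator ^ t) y‖ < 3 / 4 / 4).card ≤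
      ((Finset.range J).filter fun t => ‖(D.operator ^ t) y‖ < 3 / 4 / 4).card + 1 := by
    rw [Finset.range_add_one, Finset.filter_insert]
    split_ifs
    · exact Finset.card_insert_le _ _
    · omega
  rw [Finset.card_range] at h1
  have h4 : (((returnTimes D.operator x (Metric.ball (0 : EllOne) (3 / 4 / 4))ᶜ)ᶜ ∩
      Set.Iic J).ncard : ℝ) ≤ s + (((Finset.range J).filter fun t =>
        ‖(D.operator ^ t) y‖ < 3 / 4 / 4).card + 1) := by
    exact_mod_cast h1.trans (by omega)
  rw [div_lt_iff₀ (half_pos hε)] at hN'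
  have h5 : (N' : ℝ) ≤ J := by exact_mod_cast (by omega : N' ≤ J)
  have h6 : (N' : ℝ) * (ε / 2) ≤ J * (ε / 2) := mul_le_mul_of_nonneg_right h5 (by positivity)
  linarith

end Data
end CType

theorem mainTheorem9 (D : CType.Data) (ψ₁ ψ₂ δ τ Δ : ℕ → ℕ)
    (hD : D.IsAssociated ψ₁ ψ₂ δ τ Δ)
    (hγ : ∀ k : ℕ, 1 ≤ k →
      CType.gammaSeq ψ₁ δ τ k ≤ (2 : ℝ) ^ (-16 * (k : ℤ)) ∧
      ∀ s : ℕ, 1 ≤ s → s < k → CType.gammaSeq ψ₁ δ τ k ≤ CType.gammaSeq ψ₁ δ τ s ^ 2)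
    (hδ : Tendsto (fun k : ℕ => ((k : ℝ) * (δ k : ℝ)) / (δ (k + 1) : ℝ)) atTop (𝓝 0))
    (hΔ : Tendsto
      (fun k : ℕ => ((k : ℝ) * (δ (ψ₂ k) : ℝ) + (CType.nSeq ψ₁ (k + 1) : ℝ)) / (Δ k : ℝ))
      atTop (𝓝 0)) :
    ¬ CType.FrequentlyHypercyclic D.operator ∧
      ∀ x : CType.EllOne, CType.IsHypercyclicVector D.operator x →
        ∃ r : ℝ, 0 < r ∧
          CType.upperDensity
            (CType.returnTimes D.operator x (Metric.ball (0 : CType.EllOne) r)ᶜ) = 1 := by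
  have hP := hD.profile fun k hk => (hγ k hk).1
  have main : ∀ x : CType.EllOne, CType.IsHypercyclicVector D.operator x →
      ∃ r : ℝ, 0 < r ∧ CType.upperDensity
        (CType.returnTimes D.operator x (Metric.ball (0 : CType.EllOne) r)ᶜ) = 1 := fun x hx =>
    hP.exists_upperDensity_eq_one (fun ε hε => hD.exists_low_le_len hΔ hε)
      (fun ε hε => hD.exists_low_le_delta hδ hε) (fun n => by omega) hx
  refine ⟨?_, main⟩
  rintro ⟨x, hx⟩
  obtain ⟨r, hr, hdens⟩ := main x hx.isHypercyclicVector
  rw [CType.returnTimes_compl] at hdens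
  exact (CType.lowerDensity_le_of_upperDensity_compl_eq_one hdens).not_gt
    (hx _ Metric.isOpen_ball (Metric.nonempty_ball.2 hr))
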